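/- Let $n \geq 1$ be an integer. For an irrational real number $\xi$, define its $n$-approximability \[ \lambda_n(\xi) = \limsup_{\frac{s}{t} \in \mathbb{Q},\ \frac{s}{t} \to \xi} \frac{\gcd(t,n)}{t^2 \left|\frac{s}{t} - \xi\right|} \in \mathbb{R} \cup \{\infty\}, \] where $s/t$ runs over rational numbers written in lowest terms with $t > 0$. Let \[ \mathcal{L}_n = \{\lambda_n(\xi) : \xi \in \mathbb{R} \setminus \mathbb{Q},\ \lambda_n(\xi) < \infty\} \subseteq \mathbb{R} \] be the $n$-Lagrange spectrum, and let $\mathcal{P}_n \subseteq \mathcal{L}_n$ be the set of real values $\lambda_n(\xi)$ attained at quadratic irrationals $\xi$, that is, at irrational real roots of quadratic polynomials with integer coefficients. Then $\mathcal{L}_n$ is a closed subset of $\mathbb{R}$. More strongly, $\mathcal{L}_n$ is the closure of $\mathcal{P}_n$ in $\mathbb{R}$. -/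

import Mathlib

open Filter Topology

noncomputable section

/-- The `n`-quality `gcd(t, n) / (t² |s/t - ξ|)` of a rational approximation `q = s/t`
(in lowest terms) to a real number `ξ`. -/
def nQuality (n : ℕ) (ξ : ℝ) (q : ℚ) : ℝ :=
  (Nat.gcd q.den n : ℝ) / ((q.den : ℝ) ^ 2 * |(q : ℝ) - ξ|)

/-- The `n`-approximability `λ_n(ξ)`: the limsup of the `n`-qualities of the rationals `s/t`
as `s/t → ξ`, with values in the extended reals (it may be `∞`). -/
def nApproximability (n : ℕ) (ξ : ℝ) : EReal :=
  limsup (fun q : ℚ => (nQuality n ξ q : EReal)) (comap (fun q : ℚ => (q : ℝ)) (𝓝[≠] ξ))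

/-- The `n`-Lagrange spectrum: the set of real (finite) values of `λ_n` at irrational numbers. -/
def nLagrangeSpectrum (n : ℕ) : Set ℝ :=
  {α : ℝ | ∃ ξ : ℝ, Irrational ξ ∧ nApproximability n ξ = (α : EReal)}

/-- Quadratic irrationals: irrational real roots of quadratic polynomials with integer
coefficients. -/
def IsQuadraticIrrational (ξ : ℝ) : Prop :=
  Irrational ξ ∧ ∃ a b c : ℤ, a ≠ 0 ∧ (a : ℝ) * ξ ^ 2 + (b : ℝ) * ξ + (c : ℝ) = 0

/-- The set of `n`-approximabilities of quadratic irrationals. -/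
def quadraticApproximabilities (n : ℕ) : Set ℝ :=
  {α : ℝ | ∃ ξ : ℝ, IsQuadraticIrrational ξ ∧ nApproximability n ξ = (α : EReal)}

end

/-! If `λ_n(ξ)` is finite, then the partial quotients of `ξ` are eventually bounded, since the
quality of a convergent is at least the corresponding complete quotient
(`eventually_completeQuotient_le`). A tail of the continued fraction then becomes a path in a finite
alphabet: a letter holds a partial quotient `b ≤ K` and the bottom row `(c, d)` modulo `n` of the
matrix of convergents, and the next row is obtained by multiplying with `(b, 1; 1, 0)`.

Write `s/t` as the image of a primitive vector `w` under a matrix of determinant `±1`. Then `gcd(t,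
n)` depends only on `w` and the row modulo `n`, while `t² |s/t - ξ|` is, up to a factor tending to
1, the absolute value at `w` of a quadratic form of discriminant one whose roots are read off the
sequence to the right and to the left of the origin. Shifting the sequence is a change of basis, so
every vector that matters can be moved into a fixed finite box. Hence `λ_n(ξ)` is the limsup, along
the shifts of the path, of one continuous function `localQuality` on a compact space
(`hasLimsup_nQuality`), and conversely every path arises from some `ξ`.

The rest is symbolic dynamics. Closing up a path between two occurrences of the same long window
gives a periodic path with nearly the same limsup (`exists_periodic_hasLimsup`), and periodic paths
code quadratic irrationals; so the spectrum lies in the closure. Conversely, periodic paths whose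
limsups tend to `a` may be chosen to agree on growing windows, and concatenating one long period of
each gives a path with limsup exactly `a` (`exists_path_hasLimsup`). Values near `a` all use the
same finite alphabet, which makes this compactness argument available. -/

/-! ### Real limits superior -/

/-- `a` is the limit superior of the real function `u` along `l`. -/
def HasLimsup {ι : Type*} (u : ι → ℝ) (l : Filter ι) (a : ℝ) : Prop :=
  ∀ ε > 0, (∀ᶠ i in l, u i ≤ a + ε) ∧ ∃ᶠ i in l, a - ε ≤ u i

theorem HasLimsup.le {ι : Type*} {u : ι → ℝ} {l : Filter ι} {a b : ℝ}
    (ha : HasLimsup u l a) (hb : ∀ᶠ i in l, u i ≤ b) : a ≤ b := by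
  refine le_of_forall_pos_le_add fun ε hε => ?_
  obtain ⟨i, hi, hi'⟩ := ((ha ε hε).2.and_eventually hb).exists
  linarith

theorem HasLimsup.ge {ι : Type*} {u : ι → ℝ} {l : Filter ι} {a b : ℝ}
    (ha : HasLimsup u l a) (hb : ∃ᶠ i in l, b ≤ u i) : b ≤ a := by
  refine le_of_forall_pos_le_add fun ε hε => ?_
  obtain ⟨i, hi, hi'⟩ := (hb.and_eventually (ha ε hε).1).exists
  linarith

theorem HasLimsup.unique {ι : Type*} {u : ι → ℝ} {l : Filter ι} {a b : ℝ}
    (ha : HasLimsup u l a) (hb : HasLimsup u l b) : a = b := by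
  apply le_antisymm
  · exact le_of_forall_pos_le_add fun ε hε => ha.le (hb ε hε).1
  · exact le_of_forall_pos_le_add fun ε hε => hb.le (ha ε hε).1

theorem exists_hasLimsup {ι : Type*} (u : ι → ℝ) (l : Filter ι) [l.NeBot] (C : ℝ)
    (hC : ∀ i, |u i| ≤ C) : ∃ a, HasLimsup u l a := by
  set S : Set ℝ := {b | ∀ᶠ i in l, u i ≤ b}
  have hS : C ∈ S := Eventually.of_forall fun i => (abs_le.1 (hC i)).2
  have hlow : BddBelow S := ⟨-C, fun b hb => by
    obtain ⟨i, hi⟩ := Eventually.exists hb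
    linarith [(abs_le.1 (hC i)).1]⟩
  refine ⟨sInf S, fun ε hε => ⟨?_, ?_⟩⟩
  · obtain ⟨b, hb, hlt⟩ := exists_lt_of_csInf_lt ⟨C, hS⟩ (show sInf S < sInf S + ε by linarith)
    exact Eventually.mono hb fun i hi => by linarith
  · intro hn
    have : sInf S - ε ∈ S := hn.mono fun i hi => (not_le.1 hi).le
    linarith [csInf_le hlow this]

theorem limsup_coe_eq_iff {ι : Type*} (u : ι → ℝ) (l : Filter ι) (a : ℝ) :
    limsup (fun i => (u i : EReal)) l = (a : EReal) ↔ HasLimsup u l a := by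
  constructor
  · intro h ε hε
    constructor
    · have : limsup (fun i => (u i : EReal)) l < ((a + ε : ℝ) : EReal) := by
        rw [h]; exact_mod_cast (by linarith : a < a + ε)
      exact (eventually_lt_of_limsup_lt this).mono fun i hi => by exact_mod_cast hi.le
    · have : ((a - ε : ℝ) : EReal) < limsup (fun i => (u i : EReal)) l := by
        rw [h]; exact_mod_cast (by linarith : a - ε < a)
      exact (frequently_lt_of_lt_limsup (by isBoundedDefault) this).mono
        fun i hi => by exact_mod_cast hi.le
  · intro h
    apply le_antisymm
    · refine EReal.le_of_forall_lt_iff_le.1 fun z hz => ?_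
      have hz' : a < z := by exact_mod_cast hz
      exact limsup_le_of_le (by isBoundedDefault) (((h (z - a) (by linarith)).1).mono
        fun i hi => by exact_mod_cast (by linarith : u i ≤ z))
    · refine EReal.ge_of_forall_gt_iff_ge.1 fun z hz => ?_
      have hz' : z < a := by exact_mod_cast hz
      exact le_limsup_of_frequently_le (((h (a - z) (by linarith)).2).mono
        fun i hi => by exact_mod_cast (by linarith : z ≤ u i)) (by isBoundedDefault)

/-! ### Symbolic dynamics: closing up and concatenating paths -/

section Paths

variable {A : Type*}

/-- The shift of a two-sided sequence by `k`. -/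
def shiftSeq (k : ℤ) (x : ℤ → A) : ℤ → A := fun i => x (i + k)

/-- Two-sided sequences whose nonnegative part follows the relation `T`. -/
def IsPath (T : A → A → Prop) (x : ℤ → A) : Prop := ∀ k : ℕ, T (x k) (x (k + 1))

/-- `F` is determined up to a small error by long central windows. -/
def WindowContinuous (F : (ℤ → A) → ℝ) : Prop :=
  ∀ ε > 0, ∃ N : ℕ, ∀ x y : ℤ → A, (∀ i : ℤ, |i| ≤ N → x i = y i) → |F x - F y| ≤ ε

/-- Compactness of `A^ℤ`: along a convergent subsequence each coordinate is eventually constant,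
since `A` is discrete. -/
theorem exists_windowLimit [Finite A] (x : ℕ → ℤ → A) :
    ∃ z : ℤ → A, ∀ m : ℕ, ∃ j ≥ m, ∀ i : ℤ, |i| ≤ m → x j i = z i := by
  let _ : TopologicalSpace A := ⊥
  have : DiscreteTopology A := ⟨rfl⟩
  obtain ⟨z, -, φ, hφ, hz⟩ := isCompact_univ.tendsto_subseq (fun m => Set.mem_univ (x m))
  refine ⟨z, fun m => ?_⟩
  have h1 : ∀ᶠ j in atTop, ∀ i ∈ Finset.Icc (-(m : ℤ)) m, x (φ j) i = z i := by
    rw [eventually_all_finset]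
    intro i _
    have := (tendsto_pi_nhds.1 hz) i
    rw [nhds_discrete, tendsto_pure] at this
    exact this
  obtain ⟨j, hj, hj'⟩ := (h1.and (eventually_ge_atTop m)).exists
  exact ⟨φ j, hj'.trans (hφ.id_le j), fun i hi =>
    hj i (Finset.mem_Icc.2 (abs_le.1 hi))⟩

/-- Uniform continuity on the compact space `A^ℤ`: pairs violating it on growing windows would have
a common limit point. -/
theorem WindowContinuous.of_continuous [Finite A] [TopologicalSpace A] [DiscreteTopology A]
    {F : (ℤ → A) → ℝ} (hF : Continuous F) : WindowContinuous F := by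
  by_contra hcon
  simp only [WindowContinuous, not_forall, not_exists] at hcon
  obtain ⟨ε, hε, hcon⟩ := hcon
  choose x y hxy hlt using hcon
  obtain ⟨z, -, φ, hφ, hz⟩ := isCompact_univ.tendsto_subseq (fun m => Set.mem_univ (x m))
  have hz' : Tendsto (y ∘ φ) atTop (𝓝 z) := by
    rw [tendsto_pi_nhds] at hz ⊢
    intro i
    refine (hz i).congr' ?_
    filter_upwards [eventually_ge_atTop i.natAbs] with j hj
    refine hxy _ i ?_
    have := hφ.id_le j
    simp only [id] at this
    rw [Int.abs_eq_natAbs]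
    omega
  have h := ((hF.tendsto z).comp hz).sub ((hF.tendsto z).comp hz')
  rw [sub_self] at h
  obtain ⟨j, hj⟩ := ((Metric.tendsto_nhds.1 h) ε hε).exists
  rw [Real.dist_eq, sub_zero] at hj
  exact hlt (φ j) hj.le

theorem periodic_emod {z : ℤ → A} {p : ℤ} (hz : Function.Periodic z p) (i j : ℤ)
    (h : p ∣ i - j) : z i = z j := by
  obtain ⟨q, hq⟩ := h
  have := hz.int_mul q j
  rw [← this]; congr 1; simp only [Int.cast_id]; linarith

variable {T : A → A → Prop} {F : (ℤ → A) → ℝ}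

theorem shiftSeq_periodic {z : ℤ → A} {p : ℤ} (hz : Function.Periodic z p) (i j : ℤ)
    (h : p ∣ i - j) : shiftSeq i z = shiftSeq j z := by
  funext l
  exact periodic_emod hz _ _ (by rwa [add_sub_add_left_eq_sub])

theorem IsPath.of_periodic {z : ℤ → A} {p : ℤ} (hp : 0 < p) (hz : Function.Periodic z p)
    (hT : IsPath T z) (k : ℤ) : T (z k) (z (k + 1)) := by
  have h := hT (k % p).toNat
  rw [Int.toNat_of_nonneg (Int.emod_nonneg k hp.ne')] at h
  have hd : p ∣ k % p - k := ⟨-(k / p), by linarith [Int.emod_add_mul_ediv k p]⟩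
  rwa [periodic_emod hz (k % p) k hd,
    periodic_emod hz (k % p + 1) (k + 1) (by simpa using hd)] at h

/-- Values of `F` along a path that returns to the same window can be approximated by the values
along a periodic path. -/
theorem exists_periodic_hasLimsup [Finite A] (hF : WindowContinuous F) {C : ℝ}
    (hC : ∀ x, |F x| ≤ C) {x : ℤ → A} (hx : IsPath T x) {a : ℝ}
    (ha : HasLimsup (fun k : ℕ => F (shiftSeq k x)) atTop a) {ε : ℝ} (hε : 0 < ε) :
    ∃ (y : ℤ → A) (p : ℤ) (b : ℝ), 0 < p ∧ Function.Periodic y p ∧ IsPath T y ∧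
      HasLimsup (fun k : ℕ => F (shiftSeq k y)) atTop b ∧ |b - a| ≤ ε := by
  obtain ⟨N, hN⟩ := hF (ε / 2) (by linarith)
  obtain ⟨hup, hfr⟩ := ha (ε / 2) (by linarith)
  obtain ⟨k₀, hk₀⟩ := eventually_atTop.1 hup
  set W : ℕ → (Finset.Icc (-((N : ℤ) + 1)) (N + 1) → A) := fun k i => x (i + k)
  have hinf : {k : ℕ | k₀ + N + 1 ≤ k ∧ a - ε / 2 ≤ F (shiftSeq k x)}.Infinite := by
    rw [← Nat.frequently_atTop_iff_infinite]
    exact ((hfr.and_eventually (eventually_ge_atTop (k₀ + N + 1))).mono fun k hk => ⟨hk.2, hk.1⟩)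
  -- Pigeonhole on the finitely many windows. The radius is `N + 1` rather than `N` so that the
  -- transition to the next letter is also covered, and the gap `N + 2` lets a window wrap around
  -- the period at most once.
  have : ∃ k l : ℕ, k₀ + N + 1 ≤ k ∧ a - ε / 2 ≤ F (shiftSeq k x) ∧ k + N + 2 ≤ l ∧ W k = W l := by
    have := hinf.to_subtype
    obtain ⟨w, hw⟩ := Finite.exists_infinite_fiber
      (fun k : {k : ℕ | k₀ + N + 1 ≤ k ∧ a - ε / 2 ≤ F (shiftSeq k x)} => W k)
    have hw' := (Set.infinite_coe_iff.1 hw).image (f := Subtype.val) Subtype.val_injective.injOn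
    obtain ⟨k, ⟨⟨k, hk⟩, hkw, rfl⟩, -⟩ := hw'.exists_gt 0
    obtain ⟨l, ⟨⟨l, hl⟩, hlw, rfl⟩, hlt⟩ := hw'.exists_gt (k + N + 1)
    exact ⟨k, l, hk.1, hk.2, hlt, hkw.trans hlw.symm⟩
  obtain ⟨k, l, hk, hFk, hkl, hW⟩ := this
  have hWin : ∀ i : ℤ, |i| ≤ N + 1 → x (i + k) = x (i + l) := fun i hi =>
    congrFun hW ⟨i, Finset.mem_Icc.2 (abs_le.1 hi)⟩
  set p : ℤ := l - k with hp
  have hp0 : 0 < p := by omega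
  set y : ℤ → A := fun i => x (i % p + k) with hy
  have hyper : Function.Periodic y p := fun i => by simp [hy]
  -- Around every position the periodic sequence looks like `x` around a position of the block `[k,
  -- l)`, since the windows at the two ends of the block agree.
  have key : ∀ j i : ℤ, |i| ≤ N + 1 → y (i + j) = x (i + (j % p + k)) := by
    intro j i hi
    have h0 := Int.emod_nonneg j hp0.ne'
    have h1 := Int.emod_lt_of_pos j hp0
    set m := j % p with hm
    have hmod : (i + j) % p = (i + m) % p := by simp [hm]
    obtain ⟨hi1, hi2⟩ := abs_le.1 hi
    simp only [hy, hmod]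
    rcases lt_or_ge (i + m) 0 with hneg | hpos
    · have : (i + m) % p = i + m + p := by
        rw [← Int.add_emod_right, Int.emod_eq_of_lt] <;> omega
      rw [this, ← add_assoc, hWin (i + m) (abs_le.2 (by omega))]
      congr 1; omega
    · rcases lt_or_ge (i + m) p with hlt | hge
      · rw [Int.emod_eq_of_lt hpos hlt, add_assoc]
      · have : (i + m) % p = i + m - p := by
          rw [← Int.sub_emod_right, Int.emod_eq_of_lt] <;> omega
        rw [this, hWin (i + m - p) (abs_le.2 (by omega))]
        congr 1; omega
  have hpath : IsPath T y := by
    intro j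
    have h1 := key j 0 (by simp; omega)
    have h2 := key j 1 (by rw [abs_one]; omega)
    have h0 := Int.emod_nonneg j hp0.ne'
    have h3 := hx (j % p + k).toNat
    rw [Int.toNat_of_nonneg (by omega)] at h3
    rw [zero_add, zero_add] at h1
    rw [add_comm 1 (j : ℤ), add_comm 1] at h2
    rwa [h1, h2]
  have hclose : ∀ j : ℤ, |F (shiftSeq j y) - F (shiftSeq (j % p + k) x)| ≤ ε / 2 := fun j =>
    hN _ _ fun i hi => key j i (by omega)
  obtain ⟨b, hb⟩ := exists_hasLimsup (fun k : ℕ => F (shiftSeq k y)) atTop C fun _ => hC _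
  refine ⟨y, p, b, hp0, hyper, hpath, hb, ?_⟩
  have hble : b ≤ a + ε := hb.le <| Eventually.of_forall fun j => by
    have h0 := Int.emod_nonneg (j : ℤ) hp0.ne'
    have h1 := hk₀ ((j : ℤ) % p + k).toNat (by omega)
    simp only at h1
    rw [Int.toNat_of_nonneg (by omega)] at h1
    linarith [(abs_le.1 (hclose j)).2]
  have hbge : a - ε ≤ b := hb.ge <| frequently_atTop.2 fun m => by
    refine ⟨m * p.toNat, Nat.le_mul_of_pos_right m (by omega), ?_⟩
    have h := hclose ((m * p.toNat : ℕ) : ℤ)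
    have : ((m * p.toNat : ℕ) : ℤ) % p = 0 := by
      push_cast
      rw [Int.toNat_of_nonneg hp0.le]; simp
    rw [this, zero_add] at h
    linarith [(abs_le.1 h).1]
  exact abs_le.2 ⟨by linarith, by linarith⟩

/-- Each value recurs at arbitrarily late positions, so the limsup bounds all shifts, including
those to negative positions. -/
theorem HasLimsup.le_of_periodic {y : ℤ → A} {p : ℤ} (hp : 0 < p) (hy : Function.Periodic y p)
    {b : ℝ} (hb : HasLimsup (fun k : ℕ => F (shiftSeq k y)) atTop b) (k : ℤ) :
    F (shiftSeq k y) ≤ b := by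
  refine le_of_forall_pos_le_add fun ε hε => ?_
  obtain ⟨m, hm⟩ := eventually_atTop.1 (hb ε hε).1
  have h0 := Int.emod_nonneg k hp.ne'
  have h := hm (k % p + m * p).toNat (by
    have : (m : ℤ) * 1 ≤ m * p := by gcongr; omega
    omega)
  simp only at h
  rw [Int.toNat_of_nonneg (by positivity)] at h
  rwa [shiftSeq_periodic hy k (k % p + m * p)]
  exact ⟨k / p - m, by linarith [Int.emod_add_mul_ediv k p, mul_comm p (m : ℤ), mul_sub p (k / p) m]⟩

/-- Concatenation of periods of paths that agree on growing windows. -/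
theorem exists_concatenation {z : ℕ → ℤ → A} {p : ℕ → ℕ} {w : ℤ → A}
    (hp : ∀ m, m + 1 < p m) (hz : ∀ m, Function.Periodic (z m) (p m : ℤ))
    (hw : ∀ (m : ℕ) (i : ℤ), |i| ≤ m + 1 → z m i = w i) (hT : ∀ m, IsPath T (z m)) :
    ∃ x : ℤ → A, IsPath T x ∧ ∃ P : ℕ → ℕ, StrictMono P ∧ P 0 = 0 ∧
      ∀ m j : ℕ, P m ≤ j → j < P (m + 1) → ∀ i : ℤ, |i| ≤ m →
        shiftSeq (j : ℤ) x i = shiftSeq ((j : ℤ) - P m) (z m) i := by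
  -- Block `m` occupies `[P m, P (m + 1))` and copies one period of `z m`. By periodicity `z m`
  -- looks like `w` at both ends of the block, and so do its neighbours; hence windows crossing a
  -- junction still look like `z m`.
  set P : ℕ → ℕ := fun m => ∑ l ∈ Finset.range m, p l with hP
  have hPs : ∀ m, P (m + 1) = P m + p m := fun m => Finset.sum_range_succ _ _
  have hPm : StrictMono P := strictMono_nat_of_lt_succ fun m => by
    rw [hPs]; have := hp m; omega
  set idx : ℤ → ℕ := fun i => Nat.findGreatest (fun m => (P m : ℤ) ≤ i) i.toNat with hidx
  have hidx_eq : ∀ (i : ℤ) (m : ℕ), (P m : ℤ) ≤ i → i < P (m + 1) → idx i = m := by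
    intro i m h1 h2
    rw [hidx]
    simp only
    rw [Nat.findGreatest_eq_iff]
    refine ⟨?_, fun _ => h1, fun l hl _ hl' => ?_⟩
    · have := hPm.id_le m; simp only [id] at this; omega
    · have := hPm.monotone (show m + 1 ≤ l from hl)
      omega
  set x : ℤ → A := fun i => if i < 0 then z 0 i else z (idx i) (i - P (idx i)) with hx
  have hP0 : P 0 = 0 := by simp [hP]
  have hin : ∀ (m : ℕ) (i : ℤ), (P m : ℤ) ≤ i → i < P (m + 1) → x i = z m (i - P m) := by
    intro m i h1 h2
    simp only [hx]
    rw [if_neg (by omega), hidx_eq i m h1 h2]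
  have hfwd : ∀ (m : ℕ) (i : ℤ), (P (m + 1) : ℤ) ≤ i → i ≤ P (m + 1) + (m + 1) →
      x i = z m (i - P m) := by
    intro m i h1 h2
    have h3 := hPs (m + 1)
    have h4 := hp (m + 1)
    have h5 := hPs m
    rw [hin (m + 1) i h1 (by omega),
      hw (m + 1) _ (abs_le.2 (by push_cast at *; omega)),
      ← hw m _ (abs_le.2 (by omega))]
    apply periodic_emod (hz m)
    exact ⟨-1, by push_cast [h5]; ring⟩
  have hbwd : ∀ (m : ℕ) (i : ℤ), (P m : ℤ) - m ≤ i → i < P m → x i = z m (i - P m) := by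
    intro m i h1 h2
    rcases m with _ | m
    · simp only [hP0] at *; omega
    · have h4 := hp m
      have h5 := hPs m
      rw [hin m i (by push_cast at *; omega) h2,
        ← periodic_emod (hz m) (i - P (m + 1)) (i - P m) ⟨-1, by push_cast [h5]; ring⟩,
        hw m _ (abs_le.2 (by push_cast at *; omega)),
        hw (m + 1) _ (abs_le.2 (by push_cast at *; omega))]
  have hwin : ∀ m j : ℕ, P m ≤ j → j < P (m + 1) → ∀ i : ℤ, -(m : ℤ) ≤ i → i ≤ m + 1 →
      x (i + j) = z m (i + (j - P m)) := by
    intro m j h1 h2 i hi hi'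
    rw [← add_sub_assoc]
    rcases lt_or_ge (i + j) (P m : ℤ) with h | h
    · exact hbwd m _ (by omega) h
    · rcases lt_or_ge (i + j) (P (m + 1) : ℤ) with h' | h'
      · exact hin m _ h h'
      · exact hfwd m _ h' (by omega)
  refine ⟨x, ?_, P, hPm, hP0, fun m j h1 h2 i hi =>
    hwin m j h1 h2 i (abs_le.1 hi).1 (by linarith [(abs_le.1 hi).2])⟩
  intro j
  obtain ⟨m, h1, h2⟩ : ∃ m, P m ≤ j ∧ j < P (m + 1) := by
    refine ⟨Nat.findGreatest (fun m => P m ≤ j) j, ?_, ?_⟩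
    · exact Nat.findGreatest_spec (P := fun m => P m ≤ j) (Nat.zero_le j) (by simp [hP0])
    · by_contra hcon
      have hcon := not_lt.1 hcon
      have := hPm.id_le (Nat.findGreatest (fun m => P m ≤ j) j + 1)
      simp only [id] at this
      have := Nat.le_findGreatest (P := fun m => P m ≤ j) (this.trans hcon) hcon
      omega
  have e1 := hwin m j h1 h2 0 (by omega) (by omega)
  have e2 := hwin m j h1 h2 1 (by omega) (by omega)
  have := (hT m).of_periodic (by have := hp m; omega) (hz m) (j - P m)
  rw [zero_add, zero_add] at e1
  rw [add_comm 1 (j : ℤ), add_comm 1] at e2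
  rwa [e1, e2]

/-- A limit of limit superiors along periodic paths is a limit superior along a path. -/
theorem exists_path_hasLimsup [Finite A] (hF : WindowContinuous F) {a : ℝ}
    (h : ∀ ε > 0, ∃ (y : ℤ → A) (p : ℤ) (b : ℝ), 0 < p ∧ Function.Periodic y p ∧ IsPath T y ∧
      HasLimsup (fun k : ℕ => F (shiftSeq k y)) atTop b ∧ |b - a| ≤ ε) :
    ∃ x : ℤ → A, IsPath T x ∧ HasLimsup (fun k : ℕ => F (shiftSeq k x)) atTop a := by
  have h' : ∀ m : ℕ, ∃ (y : ℤ → A) (p : ℤ), 0 < p ∧ Function.Periodic y p ∧ IsPath T y ∧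
      (∀ k : ℤ, F (shiftSeq k y) ≤ a + 1 / (m + 1)) ∧ a - 1 / (m + 1) ≤ F y := by
    intro m
    have hm : (0 : ℝ) < 1 / (m + 1) := by positivity
    obtain ⟨y, p, b, hp, hy, hT, hb, hba⟩ := h (1 / (m + 1) / 2) (by positivity)
    obtain ⟨k, hk⟩ := (hb (1 / (m + 1) / 2) (by positivity)).2.exists
    obtain ⟨hb1, hb2⟩ := abs_le.1 hba
    -- Recentring puts a nearly maximal value at the origin, so that each block of the concatenation
    -- will start with one.
    refine ⟨shiftSeq (k : ℤ) y, p, hp, fun i => ?_, fun i => ?_, fun j => ?_, by linarith⟩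
    · simp only [shiftSeq]; rw [add_right_comm]; exact hy _
    · simp only [shiftSeq]; rw [add_right_comm]; exact hT.of_periodic hp hy _
    · have := hb.le_of_periodic hp hy (j + k)
      have e : shiftSeq j (shiftSeq (k : ℤ) y) = shiftSeq (j + k) y := by
        funext i; simp only [shiftSeq]; rw [add_assoc]
      rw [e]; linarith
  choose y p hp hy hT hle hge using h'
  obtain ⟨w, hw⟩ := exists_windowLimit y
  choose φ hφ hyw using fun m => hw (m + 1)
  -- The period is repeated `m + 2` times to exceed the radius `m + 1` on which the sequences agree
  -- with `w`.
  obtain ⟨x, hx, P, hPm, hP0, hwin⟩ := exists_concatenation (T := T) (z := fun m => y (φ m))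
    (p := fun m => (m + 2) * (p (φ m)).toNat) (w := w)
    (fun m => by have := hp (φ m); nlinarith [Int.toNat_of_nonneg this.le, show 1 ≤ (p (φ m)).toNat by omega])
    (fun m i => periodic_emod (hy (φ m)) _ _ ⟨m + 2, by
      push_cast; rw [Int.toNat_of_nonneg (hp _).le]; ring⟩)
    (fun m i hi => hyw m i (by exact_mod_cast hi)) (fun m => hT _)
  have hφ' : ∀ m, (1 : ℝ) / (φ m + 1) ≤ 1 / (m + 1) := fun m => by
    have : (m : ℝ) ≤ φ m := by exact_mod_cast (Nat.le_succ m).trans (hφ m)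
    gcongr
  refine ⟨x, hx, fun ε hε => ?_⟩
  obtain ⟨N, hN⟩ := hF (ε / 2) (by linarith)
  obtain ⟨M, hM⟩ := exists_nat_one_div_lt (show 0 < ε / 2 by linarith)
  have hM' : ∀ m ≥ M, (1 : ℝ) / (φ m + 1) ≤ ε / 2 := fun m hm => by
    have : (1 : ℝ) / (m + 1) ≤ 1 / (M + 1) := by
      have : (M : ℝ) ≤ m := by exact_mod_cast hm
      gcongr
    linarith [hφ' m]
  have hclose : ∀ m j : ℕ, N ≤ m → P m ≤ j → j < P (m + 1) →
      |F (shiftSeq j x) - F (shiftSeq ((j : ℤ) - P m) (y (φ m)))| ≤ ε / 2 :=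
    fun m j hm h1 h2 => hN _ _ fun i hi => hwin m j h1 h2 i (hi.trans (by exact_mod_cast hm))
  constructor
  · filter_upwards [eventually_ge_atTop (P (max M N))] with j hj
    obtain ⟨m, hm, h1, h2⟩ : ∃ m, max M N ≤ m ∧ P m ≤ j ∧ j < P (m + 1) := by
      have hjj : max M N ≤ j := (hPm.id_le _).trans hj
      refine ⟨Nat.findGreatest (fun m => P m ≤ j) j, Nat.le_findGreatest hjj hj, ?_, ?_⟩
      · exact Nat.findGreatest_spec (P := fun m => P m ≤ j) hjj hj
      · by_contra hcon
        have hcon := not_lt.1 hcon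
        have := hPm.id_le (Nat.findGreatest (fun m => P m ≤ j) j + 1)
        simp only [id] at this
        have := Nat.le_findGreatest (P := fun m => P m ≤ j) (this.trans hcon) hcon
        omega
    have := hclose m j ((le_max_right _ _).trans hm) h1 h2
    linarith [(abs_le.1 this).2, hle (φ m) (j - P m), hM' m ((le_max_left _ _).trans hm)]
  · rw [frequently_atTop]
    intro j
    set m := max j (max M N)
    have hmj : j ≤ m := le_max_left _ _
    have hmM : M ≤ m := (le_max_left _ _).trans (le_max_right _ _)
    have hmN : N ≤ m := (le_max_right _ _).trans (le_max_right _ _)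
    refine ⟨P m, hmj.trans (hPm.id_le m), ?_⟩
    have := hclose m (P m) hmN le_rfl (hPm (Nat.lt_succ_self m))
    have e : shiftSeq ((P m : ℤ) - P m) (y (φ m)) = y (φ m) := by
      funext i; simp [shiftSeq]
    rw [e] at this
    linarith [(abs_le.1 this).1, hge (φ m), hM' m hmM]

end Paths

/-! ### Continued fractions with bounded partial quotients -/

noncomputable section ContinuedFractions

variable {K : ℕ}

/-- Truncations of the continued fraction with partial quotients `b i + 1`. -/
def cfTrunc : ℕ → (ℕ → Fin K) → ℝ
  | 0, _ => 2
  | m + 1, b => ((b 0 : ℕ) + 1 : ℝ) + 1 / cfTrunc m (fun i => b (i + 1))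

/-- The value of the infinite continued fraction with partial quotients `b i + 1`. -/
def cfValue (b : ℕ → Fin K) : ℝ := 2 + ∑' m, (cfTrunc (m + 1) b - cfTrunc m b)

/-- The smallest growth factor of the remainders of a continued fraction. -/
def cfRate (K : ℕ) : ℝ := 1 + 1 / (K + 1)

theorem one_lt_cfRate (K : ℕ) : 1 < cfRate K := by
  unfold cfRate
  have : (0 : ℝ) < 1 / (K + 1) := by positivity
  linarith

theorem cfRate_pos (K : ℕ) : 0 < cfRate K := zero_lt_one.trans (one_lt_cfRate K)

theorem digit_bounds (a : Fin K) : (1 : ℝ) ≤ (a : ℕ) + 1 ∧ ((a : ℕ) + 1 : ℝ) ≤ K :=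
  ⟨by simp, by exact_mod_cast a.isLt⟩

theorem cf_step_bounds (a : Fin K) {z : ℝ} (h1 : 1 ≤ z) (h2 : z ≤ K + 1) :
    cfRate K ≤ (a : ℕ) + 1 + 1 / z ∧ (a : ℕ) + 1 + 1 / z ≤ K + 1 := by
  obtain ⟨ha, ha'⟩ := digit_bounds a
  have h3 : 1 / z ≤ 1 := by rw [div_le_one (by linarith)]; exact h1
  have h4 : 1 / ((K : ℝ) + 1) ≤ 1 / z := one_div_le_one_div_of_le (by linarith) h2
  exact ⟨by unfold cfRate; linarith, by linarith⟩

theorem cfTrunc_bounds (m : ℕ) (b : ℕ → Fin K) :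
    cfRate K ≤ cfTrunc m b ∧ cfTrunc m b ≤ K + 1 := by
  induction m generalizing b with
  | zero =>
    have : (1 : ℝ) ≤ K := (digit_bounds (b 0)).1.trans (digit_bounds (b 0)).2
    have h : 1 / ((K : ℝ) + 1) ≤ 1 := by rw [div_le_one (by linarith)]; linarith
    exact ⟨by unfold cfRate cfTrunc; linarith, by unfold cfTrunc; linarith⟩
  | succ m ih =>
    obtain ⟨h1, h2⟩ := ih fun i => b (i + 1)
    exact cf_step_bounds _ ((one_lt_cfRate K).le.trans h1) h2

/-- The difference is `(z - y) / (y z)`, and `y z ≥ cfRate K ^ 2 ≥ cfRate K`. -/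
theorem cf_contract (a : ℝ) {y z : ℝ} (hy : cfRate K ≤ y) (hz : cfRate K ≤ z) :
    |(a + 1 / y) - (a + 1 / z)| ≤ (cfRate K)⁻¹ * |y - z| := by
  have h1 := one_lt_cfRate K
  have hy0 : 0 < y := by linarith
  have hz0 : 0 < z := by linarith
  have e : (a + 1 / y) - (a + 1 / z) = (y * z)⁻¹ * (z - y) := by field_simp; ring
  rw [e, abs_mul, abs_sub_comm z y, abs_of_pos (by positivity)]
  gcongr
  nlinarith

theorem cfTrunc_succ_sub (m : ℕ) (b : ℕ → Fin K) :
    |cfTrunc (m + 1) b - cfTrunc m b| ≤ (cfRate K)⁻¹ ^ m * (K + 1) := by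
  induction m generalizing b with
  | zero =>
    obtain ⟨h1, h2⟩ := cfTrunc_bounds 0 b
    obtain ⟨h3, h4⟩ := cfTrunc_bounds 1 b
    have := cfRate_pos K
    rw [pow_zero, one_mul, abs_le]
    constructor <;> linarith
  | succ m ih =>
    have h := cf_contract ((b 0 : ℕ) + 1 : ℝ) (cfTrunc_bounds (m + 1) fun i => b (i + 1)).1
      (cfTrunc_bounds m fun i => b (i + 1)).1
    refine h.trans ?_
    rw [pow_succ', mul_assoc]
    have := cfRate_pos K
    gcongr
    exact ih _

theorem summable_cfRate (K : ℕ) : Summable fun m : ℕ => (cfRate K)⁻¹ ^ m * ((K : ℝ) + 1) :=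
  (summable_geometric_of_lt_one (inv_nonneg.2 (cfRate_pos K).le)
    (inv_lt_one_of_one_lt₀ (one_lt_cfRate K))).mul_right _

theorem tendsto_cfTrunc (b : ℕ → Fin K) :
    Tendsto (fun m => cfTrunc m b) atTop (𝓝 (cfValue b)) := by
  have hs : Summable fun m => cfTrunc (m + 1) b - cfTrunc m b :=
    Summable.of_norm_bounded (summable_cfRate K) fun m => cfTrunc_succ_sub m b
  have h := hs.hasSum.tendsto_sum_nat.const_add 2
  refine h.congr fun m => ?_
  rw [Finset.sum_range_sub fun m => cfTrunc m b]
  simp [cfTrunc]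

theorem continuous_cfTrunc (m : ℕ) : Continuous (cfTrunc (K := K) m) := by
  induction m with
  | zero => exact continuous_const
  | succ m ih =>
    have h0 : Continuous fun b : ℕ → Fin K => ((b 0 : ℕ) : ℝ) :=
      (continuous_of_discreteTopology (f := fun a : Fin K => ((a : ℕ) : ℝ))).comp
        (continuous_apply 0)
    have h1 : Continuous fun b : ℕ → Fin K => cfTrunc m (fun i => b (i + 1)) :=
      ih.comp (by fun_prop)
    exact (h0.add continuous_const).add (continuous_const.div h1 fun b =>
      ((cfRate_pos K).trans_le (cfTrunc_bounds m _).1).ne')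

theorem continuous_cfValue : Continuous (cfValue (K := K)) :=
  continuous_const.add <| continuous_tsum
    (fun m => (continuous_cfTrunc (m + 1)).sub (continuous_cfTrunc m))
    (summable_cfRate K) fun m b => cfTrunc_succ_sub m b

theorem cfValue_bounds (b : ℕ → Fin K) : cfRate K ≤ cfValue b ∧ cfValue b ≤ K + 1 :=
  ⟨ge_of_tendsto' (tendsto_cfTrunc b) fun m => (cfTrunc_bounds m b).1,
    le_of_tendsto' (tendsto_cfTrunc b) fun m => (cfTrunc_bounds m b).2⟩

theorem one_lt_cfValue (b : ℕ → Fin K) : 1 < cfValue b :=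
  (one_lt_cfRate K).trans_le (cfValue_bounds b).1

theorem cfValue_eq (b : ℕ → Fin K) :
    cfValue b = (b 0 : ℕ) + 1 + 1 / cfValue fun i => b (i + 1) := by
  refine tendsto_nhds_unique ((tendsto_cfTrunc b).comp (tendsto_add_atTop_nat 1)) ?_
  exact (tendsto_const_nhds.div (tendsto_cfTrunc _)
    (zero_lt_one.trans (one_lt_cfValue _)).ne').const_add _

/-- Unrolling the recursion `m` times shrinks the initial discrepancy with the truncation by the
contraction factor to the power `m`. This identifies complete quotients with values of `cfValue`. -/
theorem cfValue_unique (b : ℕ → Fin K) (z : ℕ → ℝ) (h1 : ∀ k, 1 ≤ z k) (h2 : ∀ k, z k ≤ K + 1)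
    (hz : ∀ k, z k = (b k : ℕ) + 1 + 1 / z (k + 1)) : z 0 = cfValue b := by
  have hrate : ∀ k, cfRate K ≤ z k := fun k => by
    rw [hz]; exact (cf_step_bounds _ (h1 _) (h2 _)).1
  have key : ∀ m j, |z j - cfTrunc m (fun i => b (i + j))| ≤ (cfRate K)⁻¹ ^ m * (K + 1) := by
    intro m
    induction m with
    | zero =>
      intro j
      obtain ⟨h3, h4⟩ := cfTrunc_bounds 0 (fun i => b (i + j))
      have := h1 j
      have := h2 j
      have := one_lt_cfRate K
      rw [pow_zero, one_mul, abs_le]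
      constructor <;> linarith
    | succ m ih =>
      intro j
      have h := cf_contract ((b j : ℕ) + 1 : ℝ) (hrate (j + 1))
        (cfTrunc_bounds m fun i => b (i + (j + 1))).1
      rw [← hz] at h
      have e : cfTrunc (m + 1) (fun i => b (i + j)) =
          (b j : ℕ) + 1 + 1 / cfTrunc m (fun i => b (i + (j + 1))) := by
        simp [cfTrunc, add_assoc, add_comm 1 j]
      rw [e]
      refine h.trans ?_
      rw [pow_succ', mul_assoc]
      have := cfRate_pos K
      gcongr
      exact ih _
  have h0 : Tendsto (fun m : ℕ => (cfRate K)⁻¹ ^ m * ((K : ℝ) + 1)) atTop (𝓝 0) :=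
    (summable_cfRate K).tendsto_atTop_zero
  have h3 : Tendsto (fun m => z 0 - cfTrunc m b) atTop (𝓝 0) :=
    squeeze_zero_norm (fun m => key m 0) h0
  have h4 := (tendsto_cfTrunc b).const_sub (z 0)
  linarith [tendsto_nhds_unique h3 h4]

/-- Descent on the denominator: a value `u / v` has tail value `v / (u - (b 0 + 1) v)`, which
exceeds 1, so the new denominator is strictly smaller in absolute value. -/
theorem irrational_cfValue (b : ℕ → Fin K) : Irrational (cfValue b) := by
  have key : ∀ (N : ℕ) (b : ℕ → Fin K) (u v : ℤ), v.natAbs ≤ N → v ≠ 0 →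
      (u : ℝ) ≠ cfValue b * v := by
    intro N
    induction N with
    | zero => intro b u v h h0; omega
    | succ N ih =>
      intro b u v hv h0 h
      set y := cfValue fun i => b (i + 1) with hy
      have hy1 : 1 < y := one_lt_cfValue _
      have hv' : (v : ℝ) ≠ 0 := by exact_mod_cast h0
      have e : (v : ℝ) = y * (u - ((b 0 : ℕ) + 1) * v : ℤ) := by
        push_cast
        rw [h, cfValue_eq, ← hy]
        field_simp
        ring
      have hne : (u - ((b 0 : ℕ) + 1) * v : ℤ) ≠ 0 := by
        intro h'
        rw [h'] at e
        simp at e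
        exact h0 e
      refine ih (fun i => b (i + 1)) v (u - ((b 0 : ℕ) + 1) * v) ?_ hne e
      have hlt : |((u - ((b 0 : ℕ) + 1) * v : ℤ) : ℝ)| < |(v : ℝ)| := by
        have hpos : 0 < |((u - ((b 0 : ℕ) + 1) * v : ℤ) : ℝ)| :=
          abs_pos.2 (by exact_mod_cast hne)
        conv_rhs => rw [e, abs_mul, abs_of_pos (zero_lt_one.trans hy1)]
        nlinarith
      have : |u - ((b 0 : ℕ) + 1) * v| < |v| := by exact_mod_cast hlt
      rw [Int.abs_eq_natAbs, Int.abs_eq_natAbs] at this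
      omega
  rintro ⟨q, hq⟩
  refine key _ b q.num q.den le_rfl (by exact_mod_cast q.den_nz) ?_
  rw [← hq]
  have : (q.den : ℝ) ≠ 0 := by exact_mod_cast q.den_nz
  rw [Rat.cast_def]
  push_cast
  field_simp

end ContinuedFractions

/-! ### Quadratic forms coded by two-sided sequences -/

noncomputable section Coding

variable {K n : ℕ}

/-- A partial quotient (minus one) together with the bottom row modulo `n` of a matrix of
convergents. -/
abbrev Letter (K n : ℕ) := Fin K × ZMod n × ZMod n

/-- The continued fraction read to the right from position `0`. -/
def up (x : ℤ → Letter K n) : ℝ := cfValue fun i : ℕ => (x i).1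

/-- The continued fraction read to the left from position `-1`. -/
def dn (x : ℤ → Letter K n) : ℝ := cfValue fun i : ℕ => (x (-1 - i)).1

/-- The partial quotient at position `0`. -/
def digit (x : ℤ → Letter K n) : ℤ := ((x 0).1 : ℕ) + 1

theorem one_lt_up (x : ℤ → Letter K n) : 1 < up x := one_lt_cfValue _

theorem one_lt_dn (x : ℤ → Letter K n) : 1 < dn x := one_lt_cfValue _

theorem up_le (x : ℤ → Letter K n) : up x ≤ K + 1 := (cfValue_bounds _).2

theorem dn_le (x : ℤ → Letter K n) : dn x ≤ K + 1 := (cfValue_bounds _).2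

theorem continuous_up : Continuous (up (K := K) (n := n)) :=
  continuous_cfValue.comp (by fun_prop)

theorem continuous_dn : Continuous (dn (K := K) (n := n)) :=
  continuous_cfValue.comp (by fun_prop)

theorem up_eq (x : ℤ → Letter K n) : up x = digit x + 1 / up (shiftSeq 1 x) := by
  unfold up
  rw [cfValue_eq]
  simp [digit, shiftSeq]

theorem dn_shiftSeq (x : ℤ → Letter K n) : dn (shiftSeq 1 x) = digit x + 1 / dn x := by
  unfold dn
  rw [cfValue_eq]
  have : ∀ i : ℕ, (-1 - ((i : ℤ) + 1) + 1) = -1 - i := fun i => by ring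
  simp [digit, shiftSeq, this]

theorem shiftSeq_add {A : Type*} (j k : ℤ) (x : ℤ → A) :
    shiftSeq j (shiftSeq k x) = shiftSeq (j + k) x := by
  funext i; simp only [shiftSeq]; rw [add_assoc]

theorem shiftSeq_zero {A : Type*} (x : ℤ → A) : shiftSeq 0 x = x := by
  funext i; simp [shiftSeq]

/-- The linear form vanishing at the right end of the geodesic coded by `x`. -/
def upForm (x : ℤ → Letter K n) (w : ℤ × ℤ) : ℝ := |(w.1 : ℝ) - up x * w.2|

/-- The linear form vanishing at the left end of the geodesic coded by `x`. -/
def dnForm (x : ℤ → Letter K n) (w : ℤ × ℤ) : ℝ := |dn x * w.1 + w.2|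

/-- The absolute value of the quadratic form of discriminant one coded by `x`. -/
def quadForm (x : ℤ → Letter K n) (w : ℤ × ℤ) : ℝ :=
  upForm x w * dnForm x w / (up x * dn x + 1)

theorem upForm_pos (x : ℤ → Letter K n) {w : ℤ × ℤ} (hw : w ≠ 0) : 0 < upForm x w := by
  refine abs_pos.2 fun h => ?_
  by_cases h2 : w.2 = 0
  · refine hw (Prod.ext ?_ h2)
    rw [h2] at h
    simpa using h
  · refine irrational_cfValue (fun i : ℕ => (x i).1) ⟨w.1 / w.2, ?_⟩
    have h2' : (w.2 : ℝ) ≠ 0 := by exact_mod_cast h2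
    push_cast
    rw [div_eq_iff h2']
    change (w.1 : ℝ) = up x * w.2
    linarith

theorem dnForm_pos (x : ℤ → Letter K n) {w : ℤ × ℤ} (hw : w ≠ 0) : 0 < dnForm x w := by
  refine abs_pos.2 fun h => ?_
  by_cases h1 : w.1 = 0
  · refine hw (Prod.ext h1 ?_)
    rw [h1] at h
    simpa using h
  · refine irrational_cfValue (fun i : ℕ => (x (-1 - i)).1) ⟨-w.2 / w.1, ?_⟩
    have h1' : (w.1 : ℝ) ≠ 0 := by exact_mod_cast h1
    push_cast
    rw [div_eq_iff h1']
    change -(w.2 : ℝ) = dn x * w.1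
    linarith

theorem one_lt_up_mul_dn (x : ℤ → Letter K n) : 1 < up x * dn x :=
  one_lt_mul_of_lt_of_le (one_lt_up x) (one_lt_dn x).le

theorem quadForm_pos (x : ℤ → Letter K n) {w : ℤ × ℤ} (hw : w ≠ 0) : 0 < quadForm x w :=
  div_pos (mul_pos (upForm_pos x hw) (dnForm_pos x hw)) (by linarith [one_lt_up_mul_dn x])

/-! ### The shift as a change of basis -/

/-- The action of the matrix `(b, 1; 1, 0)` on integer vectors. -/
def stepEquiv (b : ℤ) : ℤ × ℤ ≃ ℤ × ℤ where
  toFun w := (b * w.1 + w.2, w.1)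
  invFun w := (w.2, w.1 - b * w.2)
  left_inv w := by ext <;> simp
  right_inv w := by ext <;> simp

theorem upForm_step (x : ℤ → Letter K n) (w : ℤ × ℤ) :
    upForm (shiftSeq 1 x) w = up (shiftSeq 1 x) * upForm x (stepEquiv (digit x) w) := by
  have h := one_lt_up (shiftSeq 1 x)
  unfold upForm
  conv_rhs => rw [← abs_of_pos (zero_lt_one.trans h), ← abs_mul, up_eq x]
  rw [← abs_neg]
  congr 1
  simp only [stepEquiv, Equiv.coe_fn_mk]
  push_cast
  field_simp
  ring

theorem dnForm_step (x : ℤ → Letter K n) (w : ℤ × ℤ) :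
    dnForm x (stepEquiv (digit x) w) = dn x * dnForm (shiftSeq 1 x) w := by
  have h := zero_lt_one.trans (one_lt_dn x)
  unfold dnForm
  rw [dn_shiftSeq, ← abs_of_pos h, ← abs_mul, abs_of_pos h]
  congr 1
  simp only [stepEquiv, Equiv.coe_fn_mk]
  push_cast
  field_simp
  ring

/-- The map `z ↦ b + 1/z` carries the roots `up` and `-1/dn` of the shifted form to those of `x`,
and determinant `-1` preserves the discriminant. -/
theorem quadForm_step (x : ℤ → Letter K n) (w : ℤ × ℤ) :
    quadForm x (stepEquiv (digit x) w) = quadForm (shiftSeq 1 x) w := by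
  have h1 := zero_lt_one.trans (one_lt_dn x)
  have h2 := zero_lt_one.trans (one_lt_up (shiftSeq 1 x))
  unfold quadForm
  rw [dnForm_step, upForm_step, dn_shiftSeq, up_eq x]
  have h3 : (0 : ℝ) ≤ digit x := by unfold digit; positivity
  rw [div_eq_div_iff (by positivity) (by positivity)]
  field_simp
  ring

/-- The matrix of the first `k` partial quotients acting on integer vectors. -/
def orbitEquiv (x : ℤ → Letter K n) : ℕ → (ℤ × ℤ ≃ ℤ × ℤ)
  | 0 => Equiv.refl _
  | k + 1 => (stepEquiv (digit (shiftSeq k x))).trans (orbitEquiv x k)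

theorem orbitEquiv_succ (x : ℤ → Letter K n) (k : ℕ) (w : ℤ × ℤ) :
    orbitEquiv x (k + 1) w = orbitEquiv x k (stepEquiv (digit (shiftSeq k x)) w) := rfl

theorem shiftSeq_one_natCast {A : Type*} (k : ℕ) (x : ℤ → A) :
    shiftSeq 1 (shiftSeq (k : ℤ) x) = shiftSeq ((k + 1 : ℕ) : ℤ) x := by
  rw [shiftSeq_add]; push_cast; rw [add_comm]

theorem upForm_orbitEquiv (x : ℤ → Letter K n) (k : ℕ) (w : ℤ × ℤ) :
    cfRate K ^ k * upForm x (orbitEquiv x k w) ≤ upForm (shiftSeq k x) w := by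
  induction k generalizing w with
  | zero => simp [orbitEquiv, shiftSeq_zero]
  | succ k ih =>
    rw [orbitEquiv_succ, ← shiftSeq_one_natCast, upForm_step, pow_succ', mul_assoc]
    exact mul_le_mul (cfValue_bounds _).1 (ih _)
      (mul_nonneg (pow_nonneg (cfRate_pos K).le _) (abs_nonneg _))
      (zero_lt_one.trans (one_lt_up _)).le

theorem quadForm_orbitEquiv (x : ℤ → Letter K n) (k : ℕ) (w : ℤ × ℤ) :
    quadForm x (orbitEquiv x k w) = quadForm (shiftSeq k x) w := by
  induction k generalizing w with
  | zero => simp [orbitEquiv, shiftSeq_zero]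
  | succ k ih => rw [orbitEquiv_succ, ih, quadForm_step, shiftSeq_one_natCast]

theorem gcd_stepEquiv (b : ℤ) (w : ℤ × ℤ) :
    Int.gcd (stepEquiv b w).1 (stepEquiv b w).2 = Int.gcd w.1 w.2 := by
  simp only [stepEquiv, Equiv.coe_fn_mk]
  rw [add_comm, Int.gcd_add_mul_right_left, Int.gcd_comm]

theorem gcd_orbitEquiv (x : ℤ → Letter K n) (k : ℕ) (w : ℤ × ℤ) :
    Int.gcd (orbitEquiv x k w).1 (orbitEquiv x k w).2 = Int.gcd w.1 w.2 := by
  induction k generalizing w with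
  | zero => rfl
  | succ k ih => rw [orbitEquiv_succ, ih, gcd_stepEquiv]

/-- The greatest common divisor with `n` of the product of a row modulo `n` and a vector. -/
def rowGcd (r : ZMod n × ZMod n) (w : ℤ × ℤ) : ℕ := Nat.gcd (r.1 * w.1 + r.2 * w.2).val n

theorem rowGcd_intCast [NeZero n] (c d : ℤ) (w : ℤ × ℤ) :
    rowGcd ((c : ZMod n), (d : ZMod n)) w = Int.gcd (c * w.1 + d * w.2) n := by
  unfold rowGcd
  have h : ((c : ZMod n) * w.1 + d * w.2) = ((c * w.1 + d * w.2 : ℤ) : ZMod n) := by push_cast; rfl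
  rw [h, ← Int.gcd_natCast_natCast, ZMod.val_intCast, Int.emod_def, Int.gcd_sub_mul_left_left]

/-- The admissible transitions between letters. -/
def Transition (l l' : Letter K n) : Prop :=
  (∃ c d : ℤ, IsCoprime c d ∧ l.2 = ((c : ZMod n), (d : ZMod n))) ∧
    l'.2 = (l.2.1 * ((l.1 : ℕ) + 1) + l.2.2, l.2.1)

/-- Associativity: `Transition` multiplies the row on the right by the matrix that `stepEquiv`
applies to the vector. -/
theorem rowGcd_orbitEquiv {x : ℤ → Letter K n} (hx : IsPath Transition x) (k : ℕ) (w : ℤ × ℤ) :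
    rowGcd (x 0).2 (orbitEquiv x k w) = rowGcd (x k).2 w := by
  induction k generalizing w with
  | zero => rfl
  | succ k ih =>
    rw [orbitEquiv_succ, ih]
    push_cast
    rw [(hx k).2]
    unfold rowGcd
    congr 2
    simp [stepEquiv, digit, shiftSeq]
    ring

/-! ### The local quality and its finite box -/

/-- Primitive integer vectors with entries of absolute value at most `R`. -/
def primitiveBox (R : ℕ) : Finset (ℤ × ℤ) :=
  (Finset.Icc (-(R : ℤ)) R ×ˢ Finset.Icc (-(R : ℤ)) R).filter fun w => Int.gcd w.1 w.2 = 1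

theorem mem_primitiveBox {R : ℕ} {w : ℤ × ℤ} :
    w ∈ primitiveBox R ↔ |w.1| ≤ R ∧ |w.2| ≤ R ∧ Int.gcd w.1 w.2 = 1 := by
  simp [primitiveBox, abs_le]
  tauto

theorem primitive_ne_zero {w : ℤ × ℤ} (h : Int.gcd w.1 w.2 = 1) : w ≠ 0 := by
  rintro rfl
  simp at h

theorem one_zero_mem_primitiveBox (R : ℕ) : (1, 0) ∈ primitiveBox (R + 1) := by
  rw [mem_primitiveBox]
  refine ⟨?_, ?_, rfl⟩ <;> simp
  positivity

/-- The best quality of a rational number near the centre of the geodesic coded by `x`. -/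
def localQuality (R : ℕ) (x : ℤ → Letter K n) : ℝ :=
  (primitiveBox (R + 1)).sup' ⟨_, one_zero_mem_primitiveBox R⟩
    fun w => (rowGcd (x 0).2 w : ℝ) / quadForm x w

theorem le_localQuality {R : ℕ} (x : ℤ → Letter K n) {w : ℤ × ℤ} (hw : w ∈ primitiveBox (R + 1)) :
    (rowGcd (x 0).2 w : ℝ) / quadForm x w ≤ localQuality R x :=
  Finset.le_sup' (fun w => (rowGcd (x 0).2 w : ℝ) / quadForm x w) hw

/-- The fixed finite box makes this a finite maximum; each numerator depends on one letter only, and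
no denominator vanishes, as both roots are irrational. -/
theorem continuous_localQuality (R : ℕ) : Continuous (localQuality (K := K) (n := n) R) := by
  refine Continuous.finset_sup'_apply _ fun w hw => ?_
  have hw0 := primitive_ne_zero (mem_primitiveBox.1 hw).2.2
  refine Continuous.div ?_ ?_ fun x => (quadForm_pos x hw0).ne'
  · exact (continuous_of_discreteTopology (f := fun l : Letter K n => (rowGcd l.2 w : ℝ))).comp
      (continuous_apply 0)
  · have h1 := continuous_up (K := K) (n := n)
    have h2 := continuous_dn (K := K) (n := n)
    unfold quadForm upForm dnForm
    refine Continuous.div (by fun_prop) (by fun_prop) fun x => ?_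
    linarith [one_lt_up_mul_dn x]

/-- The vector `(1, 0)` suffices: its form value is `dn / (up * dn + 1) ≤ 1`. The bound lets vectors
of small quality be ignored later. -/
theorem one_le_localQuality [NeZero n] (R : ℕ) (x : ℤ → Letter K n) : 1 ≤ localQuality R x := by
  refine le_trans ?_ (le_localQuality x (one_zero_mem_primitiveBox R))
  have h1 : (1 : ℝ) ≤ rowGcd (x 0).2 (1, 0) := by
    exact_mod_cast Nat.gcd_pos_of_pos_right _ (NeZero.pos n)
  rw [le_div_iff₀ (quadForm_pos x (by simp))]
  refine le_trans ?_ h1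
  rw [one_mul]
  have h2 := one_lt_dn x
  have h3 := one_lt_up x
  simp only [quadForm, upForm, dnForm]
  rw [div_le_one (by linarith [one_lt_up_mul_dn x])]
  simp
  rw [abs_of_pos (by linarith)]
  nlinarith

theorem exists_localQuality_bound [NeZero n] (R : ℕ) :
    ∃ C, ∀ x : ℤ → Letter K n, |localQuality R x| ≤ C := by
  obtain ⟨C, hC⟩ := (isCompact_univ (X := ℤ → Letter K n)).exists_bound_of_continuousOn
    (continuous_localQuality R).continuousOn
  exact ⟨C, fun x => hC x (Set.mem_univ x)⟩

/-- A radius beyond which primitive vectors are irrelevant for `localQuality`. -/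
def boxRadius (K n : ℕ) : ℕ := 2 * (2 * n * ((K + 1) ^ 2 + 1)) + K + 1

theorem abs_le_of_forms (x : ℤ → Letter K n) (w : ℤ × ℤ) :
    |(w.1 : ℝ)| ≤ upForm x w + dnForm x w ∧ |(w.2 : ℝ)| ≤ upForm x w + dnForm x w := by
  have h1 := one_lt_up x
  have h2 := one_lt_dn x
  have h3 := one_lt_up_mul_dn x
  have hp : 0 ≤ upForm x w := abs_nonneg _
  have hr : 0 ≤ dnForm x w := abs_nonneg _
  constructor
  · have e : (w.1 : ℝ) * (up x * dn x + 1) =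
      ((w.1 : ℝ) - up x * w.2) + up x * (dn x * w.1 + w.2) := by ring
    have h : |(w.1 : ℝ)| * (up x * dn x + 1) ≤ upForm x w + up x * dnForm x w := by
      rw [← abs_of_pos (show 0 < up x * dn x + 1 by linarith), ← abs_mul, e]
      refine (abs_add_le _ _).trans ?_
      rw [abs_mul (up x), abs_of_pos (show 0 < up x by linarith)]
      rfl
    refine le_of_mul_le_mul_right (h.trans ?_) (show 0 < up x * dn x + 1 by linarith)
    nlinarith [mul_nonneg hp (show 0 ≤ up x * dn x by linarith),
      mul_nonneg hr (show 0 ≤ up x * dn x + 1 - up x by nlinarith)]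
  · have e : (w.2 : ℝ) * (up x * dn x + 1) =
      (dn x * w.1 + w.2) - dn x * ((w.1 : ℝ) - up x * w.2) := by ring
    have h : |(w.2 : ℝ)| * (up x * dn x + 1) ≤ dnForm x w + dn x * upForm x w := by
      rw [← abs_of_pos (show 0 < up x * dn x + 1 by linarith), ← abs_mul, e]
      refine (abs_sub _ _).trans ?_
      rw [abs_mul (dn x), abs_of_pos (show 0 < dn x by linarith)]
      rfl
    refine le_of_mul_le_mul_right (h.trans ?_) (show 0 < up x * dn x + 1 by linarith)
    nlinarith [mul_nonneg hr (show 0 ≤ up x * dn x by linarith),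
      mul_nonneg hp (show 0 ≤ up x * dn x + 1 - dn x by nlinarith)]

/-- A primitive vector of small norm visits the box along its orbit. -/
theorem exists_mem_primitiveBox (x : ℤ → Letter K n) {w : ℤ × ℤ} (hw : Int.gcd w.1 w.2 = 1)
    (hq : quadForm x w ≤ 2 * n) (hle : upForm x w ≤ dnForm x w) :
    ∃ k : ℕ, (orbitEquiv x k).symm w ∈ primitiveBox (boxRadius K n + 1) := by
  set v : ℕ → ℤ × ℤ := fun k => (orbitEquiv x k).symm w with hv
  have hwv : ∀ k, orbitEquiv x k (v k) = w := fun k => Equiv.apply_symm_apply _ _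
  have hgcd : ∀ k, Int.gcd (v k).1 (v k).2 = 1 := fun k => by rw [← gcd_orbitEquiv x k, hwv, hw]
  set B : ℝ := 2 * n * ((K + 1) ^ 2 + 1) with hB
  have hBpos : 0 ≤ B := by positivity
  have hprod : ∀ k : ℕ, upForm (shiftSeq k x) (v k) * dnForm (shiftSeq k x) (v k) ≤ B := by
    intro k
    have h : quadForm (shiftSeq k x) (v k) ≤ 2 * n := by rw [← quadForm_orbitEquiv, hwv]; exact hq
    have h3 := one_lt_up_mul_dn (shiftSeq k x)
    rw [quadForm, div_le_iff₀ (by linarith)] at h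
    refine h.trans ?_
    have := mul_le_mul (up_le (shiftSeq k x)) (dn_le (shiftSeq k x))
      (zero_lt_one.trans (one_lt_dn _)).le (by positivity)
    rw [hB]
    gcongr
    rw [sq]; exact this
  -- The up-form grows geometrically along the orbit. At the first time it reaches 1, the bounded
  -- product controls the down-form, and the previous step (or, at time 0, `hle`) controls the
  -- up-form.
  have hex : ∃ k : ℕ, 1 ≤ upForm (shiftSeq k x) (v k) := by
    have hpos := upForm_pos x (primitive_ne_zero hw)
    obtain ⟨k, hk⟩ := pow_unbounded_of_one_lt (1 / upForm x w) (one_lt_cfRate K)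
    refine ⟨k, le_trans ?_ (upForm_orbitEquiv x k (v k))⟩
    rw [hwv]
    rw [div_lt_iff₀ hpos] at hk
    exact hk.le
  classical
  have hk := Nat.find_spec hex
  have hmin := fun j => Nat.find_min hex (m := j)
  set k := Nat.find hex
  have hdn : dnForm (shiftSeq k x) (v k) ≤ B := by
    refine le_trans ?_ (hprod k)
    exact le_mul_of_one_le_left (abs_nonneg _) hk
  have hup : upForm (shiftSeq k x) (v k) ≤ B + (K + 1) := by
    rcases hk0 : k with _ | j
    · rw [hk0] at hdn
      have e : shiftSeq ((0 : ℕ) : ℤ) x = x := shiftSeq_zero x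
      have e' : v 0 = w := rfl
      rw [e, e'] at hdn ⊢
      linarith
    · have hj := not_le.1 (hmin j (by omega))
      have hvj : v j = stepEquiv (digit (shiftSeq j x)) (v (j + 1)) := by
        apply (orbitEquiv x j).injective
        rw [hwv, ← orbitEquiv_succ, hwv]
      rw [hvj] at hj
      rw [← shiftSeq_one_natCast, upForm_step]
      have := mul_le_mul (up_le (shiftSeq 1 (shiftSeq (j : ℤ) x))) hj.le (abs_nonneg _)
        (by positivity)
      linarith
  obtain ⟨h1, h2⟩ := abs_le_of_forms (shiftSeq k x) (v k)
  have hR : upForm (shiftSeq k x) (v k) + dnForm (shiftSeq k x) (v k) ≤ (boxRadius K n + 1 : ℕ) := by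
    have : ((boxRadius K n + 1 : ℕ) : ℝ) = 2 * B + K + 1 + 1 := by
      rw [hB]; unfold boxRadius; push_cast; ring
    rw [this]; linarith
  refine ⟨k, mem_primitiveBox.2 ⟨?_, ?_, hgcd k⟩⟩
  · exact_mod_cast h1.trans hR
  · exact_mod_cast h2.trans hR

end Coding

/-! ### From qualities of rationals to the local quality -/

noncomputable section Transfer

variable {K n : ℕ}

theorem nQuality_div (ξ : ℝ) {s t : ℤ} (hst : Int.gcd s t = 1) (ht : t ≠ 0) :
    nQuality n ξ ((s : ℚ) / t) = (Int.gcd t n : ℝ) / (|(t : ℝ)| * |(s : ℝ) - ξ * t|) := by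
  have htR : (t : ℝ) ≠ 0 := by exact_mod_cast ht
  have hden : ((s : ℚ) / t).den = t.natAbs := by
    rcases lt_or_gt_of_ne ht with h | h
    · have e : (s : ℚ) / t = ((-s : ℤ) : ℚ) / ((-t : ℤ) : ℚ) := by push_cast; rw [neg_div_neg_eq]
      have := Rat.den_div_eq_of_coprime (a := -s) (b := -t) (by omega) (by simpa [Int.gcd] using hst)
      rw [e]
      omega
    · have := Rat.den_div_eq_of_coprime (a := s) (b := t) h hst
      omega
  have habs : ((t.natAbs : ℕ) : ℝ) = |(t : ℝ)| := by rw [Nat.cast_natAbs]; push_cast; rfl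
  unfold nQuality
  rw [hden, habs]
  push_cast
  have e : (s : ℝ) / t - ξ = (s - ξ * t) / t := by field_simp
  rw [e, abs_div]
  have h0 : |(t : ℝ)| ≠ 0 := abs_ne_zero.2 htR
  congr 1
  field_simp

/-- A Möbius transformation `(p z + q) / (c z + d)` with integer coefficients. -/
def moebius (p q c d : ℤ) (z : ℝ) : ℝ := (p * z + q) / (c * z + d)

/-- The integer linear map underlying `moebius`. -/
def linMap (p q c d : ℤ) (w : ℤ × ℤ) : ℤ × ℤ := (p * w.1 + q * w.2, c * w.1 + d * w.2)

/-- The ratio of the quality of a rational number `z` and the value of the quadratic form. -/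
def distortion (p q c d : ℤ) (x : ℤ → Letter K n) (z : ℝ) : ℝ :=
  |c * up x + d| * |(dn x * d - c) * z + (p - dn x * q)| / (up x * dn x + 1)

section

variable {p q c d : ℤ} (hdet : p * d - q * c = 1 ∨ p * d - q * c = -1) (x : ℤ → Letter K n)

include hdet

theorem denom_ne_zero : (c : ℝ) * up x + d ≠ 0 := by
  intro h
  have h0 : ((-d, c) : ℤ × ℤ) ≠ 0 := by
    intro h0
    simp only [Prod.mk_eq_zero, neg_eq_zero] at h0
    simp [h0.1, h0.2] at hdet
  have := upForm_pos x h0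
  simp only [upForm] at this
  push_cast at this
  rw [show -(d : ℝ) - up x * c = -((c : ℝ) * up x + d) by ring, h] at this
  simp at this

theorem det_abs : |(p : ℝ) * d - q * c| = 1 := by
  rcases hdet with h | h
  · have : (p : ℝ) * d - q * c = 1 := by exact_mod_cast h
    rw [this, abs_one]
  · have : (p : ℝ) * d - q * c = -1 := by exact_mod_cast h
    rw [this, abs_neg, abs_one]

theorem upForm_linMap (w : ℤ × ℤ) :
    |(c : ℝ) * up x + d| * |((linMap p q c d w).1 : ℝ) -
      moebius p q c d (up x) * (linMap p q c d w).2| = upForm x w := by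
  have hD := denom_ne_zero hdet x
  have e : ((c : ℝ) * up x + d) * (((linMap p q c d w).1 : ℝ) -
      moebius p q c d (up x) * (linMap p q c d w).2) =
      ((p : ℝ) * d - q * c) * (w.1 - up x * w.2) := by
    simp only [linMap, moebius]
    push_cast
    field_simp
    ring
  rw [← abs_mul, e, abs_mul, det_abs hdet, one_mul, upForm]

theorem dnForm_linMap (w : ℤ × ℤ) (ht : (linMap p q c d w).2 ≠ 0) :
    |(dn x * d - c) * (((linMap p q c d w).1 : ℝ) / (linMap p q c d w).2) + (p - dn x * q)| *
      |((linMap p q c d w).2 : ℝ)| = dnForm x w := by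
  have ht' : ((linMap p q c d w).2 : ℝ) ≠ 0 := by exact_mod_cast ht
  have e : ((dn x * d - c) * (((linMap p q c d w).1 : ℝ) / (linMap p q c d w).2) + (p - dn x * q)) *
      ((linMap p q c d w).2 : ℝ) = ((p : ℝ) * d - q * c) * (dn x * w.1 + w.2) := by
    rw [add_mul, mul_assoc, div_mul_cancel₀ _ ht']
    simp only [linMap]
    push_cast
    ring
  rw [← abs_mul, e, abs_mul, det_abs hdet, one_mul, dnForm]

theorem gcd_linMap (w : ℤ × ℤ) :
    Int.gcd (linMap p q c d w).1 (linMap p q c d w).2 = 1 ↔ Int.gcd w.1 w.2 = 1 := by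
  rw [← Int.isCoprime_iff_gcd_eq_one, ← Int.isCoprime_iff_gcd_eq_one]
  have hd2 : (p * d - q * c) * (p * d - q * c) = 1 := by rcases hdet with h | h <;> rw [h] <;> rfl
  constructor
  · rintro ⟨a, b, h⟩
    refine ⟨a * p + b * c, a * q + b * d, ?_⟩
    rw [← h]; simp only [linMap]; ring
  · rintro ⟨a, b, h⟩
    refine ⟨(p * d - q * c) * (a * d - b * c), (p * d - q * c) * (b * p - a * q), ?_⟩
    simp only [linMap]
    linear_combination (a * w.1 + b * w.2) * hd2 + h

theorem exists_linMap_eq (v : ℤ × ℤ) : ∃ w, linMap p q c d w = v := by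
  have hd2 : (p * d - q * c) * (p * d - q * c) = 1 := by rcases hdet with h | h <;> rw [h] <;> rfl
  refine ⟨((p * d - q * c) * (d * v.1 - q * v.2), (p * d - q * c) * (p * v.2 - c * v.1)), ?_⟩
  ext
  · simp only [linMap]; linear_combination v.1 * hd2
  · simp only [linMap]; linear_combination v.2 * hd2

theorem distortion_moebius : distortion p q c d x (moebius p q c d (up x)) = 1 := by
  have hD := denom_ne_zero hdet x
  have h1 := one_lt_up_mul_dn x
  unfold distortion
  rw [← abs_mul, div_eq_one_iff_eq (by linarith)]
  have e : ((c : ℝ) * up x + d) * ((dn x * d - c) * moebius p q c d (up x) + (p - dn x * q)) =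
      ((p : ℝ) * d - q * c) * (up x * dn x + 1) := by
    unfold moebius
    field_simp
    ring
  rw [e, abs_mul, det_abs hdet, one_mul, abs_of_pos (by linarith)]

/-- A rational value would pull back to a nonzero integer vector with vanishing up-form. -/
theorem irrational_moebius : Irrational (moebius p q c d (up x)) := by
  rintro ⟨r, hr⟩
  obtain ⟨w, hw⟩ := exists_linMap_eq hdet (r.num, (r.den : ℤ))
  have hw0 : w ≠ 0 := by
    rintro rfl
    have := congrArg Prod.snd hw
    simp [linMap] at this
    exact r.den_nz (by exact_mod_cast this.symm)
  have h1 := upForm_linMap hdet x w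
  have hd : (r.den : ℝ) ≠ 0 := by exact_mod_cast r.den_nz
  rw [hw, ← hr, Rat.cast_def] at h1
  push_cast at h1
  rw [div_mul_cancel₀ _ hd, sub_self, abs_zero, mul_zero] at h1
  exact (upForm_pos x hw0).ne h1

/-- The exact dictionary between a rational and its vector. By `distortion_moebius` and continuity,
the last factor tends to 1 as the rational tends to `ξ`, so it does not affect the limsup. -/
theorem nQuality_linMap [NeZero n] (hrow : (x 0).2 = ((c : ZMod n), (d : ZMod n))) {w : ℤ × ℤ}
    (hw : Int.gcd w.1 w.2 = 1) (ht : (linMap p q c d w).2 ≠ 0) :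
    nQuality n (moebius p q c d (up x)) (((linMap p q c d w).1 : ℚ) / (linMap p q c d w).2) =
      (rowGcd (x 0).2 w : ℝ) / quadForm x w *
        distortion p q c d x (((linMap p q c d w).1 : ℝ) / (linMap p q c d w).2) := by
  have ht' : |((linMap p q c d w).2 : ℝ)| ≠ 0 := abs_ne_zero.2 (by exact_mod_cast ht)
  have hD := abs_ne_zero.2 (denom_ne_zero hdet x)
  have hw0 := primitive_ne_zero hw
  have h1 := upForm_linMap hdet x w
  have h2 := dnForm_linMap hdet x w ht
  have hP := upForm_pos x hw0
  have hr := dnForm_pos x hw0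
  have hN := one_lt_up_mul_dn x
  have hgcd : rowGcd (x 0).2 w = Int.gcd (linMap p q c d w).2 n := by
    rw [hrow, rowGcd_intCast]; rfl
  rw [nQuality_div _ ((gcd_linMap hdet w).2 hw) ht, hgcd, quadForm, distortion]
  rw [← h1, ← h2]
  rw [← h1] at hP
  rw [← h2] at hr
  have h3 := (pos_of_mul_pos_right hP (abs_nonneg _)).ne'
  have h4 := (pos_of_mul_pos_left hr (abs_nonneg _)).ne'
  have h5 : up x * dn x + 1 ≠ 0 := by linarith
  generalize |(dn x * d - c) * (((linMap p q c d w).1 : ℝ) / (linMap p q c d w).2) +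
    (p - dn x * q)| = H at h4 ⊢
  field_simp

end

theorem continuous_distortion (p q c d : ℤ) (x : ℤ → Letter K n) :
    Continuous (distortion p q c d x) := by
  unfold distortion
  fun_prop

/-- The filter of rational numbers approaching `ξ`. -/
abbrev ratNhds (ξ : ℝ) : Filter ℚ := comap (fun q : ℚ => (q : ℝ)) (𝓝[≠] ξ)

theorem tendsto_ratCast_ratNhds (ξ : ℝ) : Tendsto (fun q : ℚ => (q : ℝ)) (ratNhds ξ) (𝓝 ξ) :=
  tendsto_comap.mono_right nhdsWithin_le_nhds

theorem tendsto_ratNhds {ι : Type*} {l : Filter ι} {ξ : ℝ} (hξ : Irrational ξ) {f : ι → ℚ}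
    (h : Tendsto (fun i => (f i : ℝ)) l (𝓝 ξ)) : Tendsto f l (ratNhds ξ) := by
  rw [tendsto_comap_iff, tendsto_nhdsWithin_iff]
  exact ⟨h, Eventually.of_forall fun i hi => hξ ⟨f i, hi⟩⟩

theorem eventually_notMem_ratNhds {ξ : ℝ} (hξ : Irrational ξ) {S : Set ℚ} (hS : S.Finite) :
    ∀ᶠ q in ratNhds ξ, q ∉ S := by
  have hfin : ((fun q : ℚ => (q : ℝ)) '' S).Finite := hS.image _
  have : ξ ∉ (fun q : ℚ => (q : ℝ)) '' S := by rintro ⟨q, -, hq⟩; exact hξ ⟨q, hq⟩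
  filter_upwards [(tendsto_ratCast_ratNhds ξ).eventually (hfin.isClosed.isOpen_compl.mem_nhds this)]
    with q hq hqS using hq ⟨q, hqS, rfl⟩

/-- A zero `t` would force `|s| = 1`; once `|t| ≥ 1`, the error of the quotient is at most `|s - ξ
t|`. -/
theorem tendsto_div_of_tendsto_sub {ι : Type*} {l : Filter ι} {ξ : ℝ} {s t : ι → ℤ}
    (hst : ∀ i, Int.gcd (s i) (t i) = 1)
    (h : Tendsto (fun i => |(s i : ℝ) - ξ * t i|) l (𝓝 0)) :
    (∀ᶠ i in l, t i ≠ 0) ∧ Tendsto (fun i => (((s i : ℚ) / t i : ℚ) : ℝ)) l (𝓝 ξ) := by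
  have ht : ∀ᶠ i in l, t i ≠ 0 := by
    filter_upwards [h.eventually (gt_mem_nhds zero_lt_one)] with i hi h0
    have := hst i
    rw [h0] at hi this
    rw [Int.gcd_zero_right] at this
    have h1 : |s i| = 1 := by rw [Int.abs_eq_natAbs, this]; rfl
    have h2 : |(s i : ℝ)| = 1 := by exact_mod_cast h1
    simp [h2] at hi
  refine ⟨ht, ?_⟩
  rw [tendsto_iff_norm_sub_tendsto_zero]
  refine squeeze_zero' (Eventually.of_forall fun i => norm_nonneg _) ?_ h
  filter_upwards [ht] with i hi
  have hi' : (t i : ℝ) ≠ 0 := by exact_mod_cast hi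
  have h1 : (1 : ℝ) ≤ |(t i : ℝ)| := by exact_mod_cast Int.one_le_abs hi
  have e : (s i : ℝ) - ξ * t i = ((s i : ℝ) / t i - ξ) * t i := by field_simp
  push_cast
  rw [e, abs_mul, Real.norm_eq_abs]
  exact le_mul_of_one_le_right (abs_nonneg _) h1

/-- For the upper bound, a rational near `ξ` either has large form value and quality at most 1, or
its vector enters the box at a late time. For the lower bound, the maximizing vectors of the
successive boxes give rationals converging to `ξ`. -/
theorem hasLimsup_nQuality [NeZero n] {p q c d : ℤ}
    (hdet : p * d - q * c = 1 ∨ p * d - q * c = -1) {x : ℤ → Letter K n}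
    (hx : IsPath Transition x) (hrow : (x 0).2 = ((c : ZMod n), (d : ZMod n))) {a : ℝ}
    (ha : HasLimsup (fun k : ℕ => localQuality (boxRadius K n) (shiftSeq k x)) atTop a) :
    HasLimsup (nQuality n (moebius p q c d (up x))) (ratNhds (moebius p q c d (up x))) a := by
  set ξ := moebius p q c d (up x) with hξ
  have hirr : Irrational ξ := irrational_moebius hdet x
  have hD := denom_ne_zero hdet x
  have ha1 : 1 ≤ a := ha.ge (Eventually.frequently (Eventually.of_forall fun k =>
    one_le_localQuality _ _))
  have hdist : Tendsto (distortion p q c d x) (𝓝 ξ) (𝓝 1) := by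
    rw [← distortion_moebius hdet x]
    exact (continuous_distortion p q c d x).tendsto _
  intro ε hε
  constructor
  · obtain ⟨k₁, hk₁⟩ := eventually_atTop.1 (ha (ε / 2) (by linarith)).1
    -- The finitely many rationals whose vectors lie in the box at some time before `k₁`; they stay
    -- away from `ξ`.
    set E : Set ℚ := ⋃ k ∈ Finset.range k₁, (fun w => (((linMap p q c d (orbitEquiv x k w)).1 : ℚ) /
      (linMap p q c d (orbitEquiv x k w)).2)) '' (primitiveBox (boxRadius K n + 1) : Set (ℤ × ℤ))
    have hE : E.Finite := by
      refine Set.Finite.biUnion (Finset.finite_toSet _) fun k _ => ?_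
      exact (Finset.finite_toSet _).image _
    have hsmall : ∀ᶠ z in 𝓝 ξ,
        |(c : ℝ) * up x + d| * |z - ξ| < |(dn x * d - c) * z + (p - dn x * q)| := by
      have h1 : Tendsto (fun z => |(c : ℝ) * up x + d| * |z - ξ|) (𝓝 ξ) (𝓝 0) := by
        have : Continuous fun z => |(c : ℝ) * up x + d| * |z - ξ| := by fun_prop
        simpa using this.tendsto ξ
      have h2 : Tendsto (fun z => |(dn x * d - c) * z + (p - dn x * q)|) (𝓝 ξ)
          (𝓝 |(dn x * d - c) * ξ + (p - dn x * q)|) :=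
        Continuous.tendsto (by fun_prop) ξ
      refine h1.eventually_lt h2 (abs_pos.2 fun h0 => ?_)
      have := distortion_moebius hdet x
      rw [distortion, ← hξ, h0] at this
      simp at this
    -- The bound 2 turns `1 / 2`, the most that vectors of form value above `2 n` reach, into 1; the
    -- other bound turns `a + ε / 2` into `a + ε`.
    have hratio : ∀ᶠ z in 𝓝 ξ, distortion p q c d x z < min 2 ((a + ε) / (a + ε / 2)) := by
      refine hdist.eventually (gt_mem_nhds (lt_min (by norm_num) ?_))
      rw [lt_div_iff₀ (by linarith)]
      linarith
    filter_upwards [eventually_notMem_ratNhds hirr hE,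
      (tendsto_ratCast_ratNhds ξ).eventually hsmall,
      (tendsto_ratCast_ratNhds ξ).eventually hratio] with r hrE hr1 hr2
    obtain ⟨w, hw⟩ := exists_linMap_eq hdet (r.num, (r.den : ℤ))
    have hrat : r = ((linMap p q c d w).1 : ℚ) / (linMap p q c d w).2 := by
      rw [hw]; exact_mod_cast (Rat.num_div_den r).symm
    have hratR : (r : ℝ) = ((linMap p q c d w).1 : ℝ) / (linMap p q c d w).2 := by
      rw [hrat]; push_cast; rfl
    have hden : (linMap p q c d w).2 ≠ 0 := by rw [hw]; exact Int.natCast_ne_zero.2 r.den_nz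
    have hwg : Int.gcd w.1 w.2 = 1 := by
      rw [← gcd_linMap hdet w, hw]
      exact r.reduced
    have hQ := nQuality_linMap hdet x hrow hwg hden
    rw [← hrat, ← hratR, ← hξ] at hQ
    have hqpos := quadForm_pos x (primitive_ne_zero hwg)
    have hdist0 : 0 ≤ distortion p q c d x r := by
      unfold distortion
      have := one_lt_up_mul_dn x
      positivity
    rw [hQ]
    rcases lt_or_ge (2 * n : ℝ) (quadForm x w) with hbig | hle
    · have h1 : (rowGcd (x 0).2 w : ℝ) / quadForm x w ≤ 1 / 2 := by
        rw [div_le_iff₀ hqpos]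
        have : (rowGcd (x 0).2 w : ℝ) ≤ n := by
          exact_mod_cast Nat.gcd_le_right _ (NeZero.pos n)
        linarith
      have h2 := hr2.le.trans (min_le_left _ _)
      calc _ ≤ 1 / 2 * 2 := mul_le_mul h1 h2 hdist0 (by norm_num)
        _ ≤ a + ε := by linarith
    · have hforms : upForm x w ≤ dnForm x w := by
        rw [← upForm_linMap hdet x w, ← dnForm_linMap hdet x w hden, ← hratR]
        have hdR : ((linMap p q c d w).2 : ℝ) ≠ 0 := by exact_mod_cast hden
        have e : ((linMap p q c d w).1 : ℝ) - moebius p q c d (up x) * (linMap p q c d w).2 =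
            (r - ξ) * (linMap p q c d w).2 := by
          rw [hratR, ← hξ]; field_simp
        rw [e, abs_mul, ← mul_assoc]
        gcongr
      obtain ⟨k, hk⟩ := exists_mem_primitiveBox x hwg hle hforms
      set v := (orbitEquiv x k).symm w
      have hv : orbitEquiv x k v = w := Equiv.apply_symm_apply _ _
      have hkk : k₁ ≤ k := by
        by_contra hcon
        refine hrE (Set.mem_biUnion (Finset.mem_coe.2 (Finset.mem_range.2 (not_le.1 hcon))) ⟨v, hk, ?_⟩)
        simp only
        rw [hv, hrat]
      have h1 : (rowGcd (x 0).2 w : ℝ) / quadForm x w ≤ a + ε / 2 := by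
        have h2 := le_localQuality (shiftSeq k x) hk
        have h3 : (shiftSeq (k : ℤ) x 0) = x k := by simp [shiftSeq]
        rw [h3, ← rowGcd_orbitEquiv hx, ← quadForm_orbitEquiv, hv] at h2
        exact h2.trans (hk₁ k hkk)
      calc _ ≤ (a + ε / 2) * ((a + ε) / (a + ε / 2)) :=
            mul_le_mul h1 (hr2.le.trans (min_le_right _ _)) hdist0 (by linarith)
        _ = a + ε := mul_div_cancel₀ _ (by linarith)
  · have hmax : ∀ k : ℕ, ∃ w ∈ primitiveBox (boxRadius K n + 1),
        localQuality (boxRadius K n) (shiftSeq k x) =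
          (rowGcd (x k).2 w : ℝ) / quadForm (shiftSeq k x) w := fun k => by
      obtain ⟨w, hw, h⟩ := Finset.exists_mem_eq_sup' ⟨_, one_zero_mem_primitiveBox (boxRadius K n)⟩
        fun w => (rowGcd (shiftSeq k x 0).2 w : ℝ) / quadForm (shiftSeq k x) w
      refine ⟨w, hw, h.trans ?_⟩
      simp [shiftSeq]
    choose w hwbox hwval using hmax
    have hgcd : ∀ k, Int.gcd (orbitEquiv x k (w k)).1 (orbitEquiv x k (w k)).2 = 1 := fun k => by
      rw [gcd_orbitEquiv]; exact (mem_primitiveBox.1 (hwbox k)).2.2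
    set v : ℕ → ℤ × ℤ := fun k => linMap p q c d (orbitEquiv x k (w k)) with hv
    have hzero : Tendsto (fun k => |((v k).1 : ℝ) - ξ * (v k).2|) atTop (𝓝 0) := by
      set B : ℝ := (boxRadius K n + 1 : ℕ) + (K + 1) * (boxRadius K n + 1 : ℕ) with hB
      have hbound : ∀ k, |((v k).1 : ℝ) - ξ * (v k).2| ≤
          |(c : ℝ) * up x + d|⁻¹ * (B * (cfRate K)⁻¹ ^ k) := fun k => by
        have h1 := upForm_linMap hdet x (orbitEquiv x k (w k))
        have h2 := upForm_orbitEquiv x k (w k)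
        have h3 : upForm (shiftSeq k x) (w k) ≤ B := by
          obtain ⟨hb1, hb2, -⟩ := mem_primitiveBox.1 (hwbox k)
          have hb1' : |((w k).1 : ℝ)| ≤ (boxRadius K n + 1 : ℕ) := by exact_mod_cast hb1
          have hb2' : |((w k).2 : ℝ)| ≤ (boxRadius K n + 1 : ℕ) := by exact_mod_cast hb2
          refine (abs_sub _ _).trans ?_
          rw [abs_mul, abs_of_pos (zero_lt_one.trans (one_lt_up _))]
          exact add_le_add hb1' (mul_le_mul (up_le _) hb2' (abs_nonneg _) (by positivity))
        have hc := pow_pos (cfRate_pos K) k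
        rw [inv_pow, ← div_eq_inv_mul, le_div_iff₀ (abs_pos.2 hD), ← div_eq_mul_inv,
          le_div_iff₀ hc, mul_comm _ |(c : ℝ) * up x + d|, h1, mul_comm]
        exact h2.trans h3
      refine squeeze_zero (fun k => abs_nonneg _) hbound ?_
      have := tendsto_pow_atTop_nhds_zero_of_lt_one (inv_nonneg.2 (cfRate_pos K).le)
        (inv_lt_one_of_one_lt₀ (one_lt_cfRate K))
      simpa using (this.const_mul B).const_mul |(c : ℝ) * up x + d|⁻¹
    obtain ⟨ht, hlim⟩ := tendsto_div_of_tendsto_sub (fun k => (gcd_linMap hdet _).2 (hgcd k)) hzero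
    -- Chosen so that a local quality of at most `a + ε / 2` loses at most `ε / 2`.
    have hratio : ∀ᶠ z in 𝓝 ξ, 1 - ε / 2 / (a + ε) < distortion p q c d x z :=
      hdist.eventually (lt_mem_nhds (by
        have : 0 < ε / 2 / (a + ε) := by positivity
        linarith))
    refine (tendsto_ratNhds hirr hlim).frequently ?_
    obtain ⟨hup, hfr⟩ := ha (ε / 2) (by linarith)
    refine (hfr.and_eventually (hup.and (ht.and (hlim.eventually hratio)))).mono ?_
    rintro k ⟨h1, h2, h3, h4⟩
    have hQ := nQuality_linMap hdet x hrow (hgcd k) h3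
    rw [rowGcd_orbitEquiv hx, quadForm_orbitEquiv, ← hwval] at hQ
    rw [← hξ] at hQ
    refine le_of_le_of_eq ?_ hQ.symm
    push_cast at h4
    have h5 : 1 ≤ localQuality (boxRadius K n) (shiftSeq k x) := one_le_localQuality _ _
    have h6 : localQuality (boxRadius K n) (shiftSeq k x) * (1 - ε / 2 / (a + ε)) ≤
        localQuality (boxRadius K n) (shiftSeq k x) * distortion p q c d x
          (((linMap p q c d (orbitEquiv x k (w k))).1 : ℝ) /
            (linMap p q c d (orbitEquiv x k (w k))).2) :=
      mul_le_mul_of_nonneg_left h4.le (by linarith)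
    refine le_trans ?_ h6
    have h7 : localQuality (boxRadius K n) (shiftSeq k x) * (ε / 2 / (a + ε)) ≤ ε / 2 := by
      rw [← mul_div_assoc, div_le_iff₀ (by linarith), mul_comm]
      have : 0 ≤ ε / 2 := by linarith
      gcongr
      linarith
    linarith

end Transfer

/-! ### Complete quotients and the coding of irrationals -/

noncomputable section Spectrum

variable {K n : ℕ}

/-- The complete quotients of a real number. -/
def completeQuotient (ξ : ℝ) : ℕ → ℝ
  | 0 => ξ
  | k + 1 => (Int.fract (completeQuotient ξ k))⁻¹

/-- The partial quotients of a real number. -/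
def partialQuotient (ξ : ℝ) (k : ℕ) : ℤ := ⌊completeQuotient ξ k⌋

/-- The product of a row with the matrices `(b i, 1; 1, 0)` for `i < k`. -/
def convergentRow (b : ℕ → ℤ) (r : ℤ × ℤ) : ℕ → ℤ × ℤ
  | 0 => r
  | k + 1 => ((convergentRow b r k).1 * b k + (convergentRow b r k).2, (convergentRow b r k).1)

theorem irrational_completeQuotient {ξ : ℝ} (hξ : Irrational ξ) (k : ℕ) :
    Irrational (completeQuotient ξ k) := by
  induction k with
  | zero => exact hξ
  | succ k ih => exact irrational_inv_iff.2 (ih.sub_intCast _)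

theorem one_lt_completeQuotient {ξ : ℝ} (hξ : Irrational ξ) (k : ℕ) :
    1 < completeQuotient ξ (k + 1) := by
  have h0 : 0 < Int.fract (completeQuotient ξ k) := by
    refine lt_of_le_of_ne (Int.fract_nonneg _) fun h => ?_
    have := (irrational_completeQuotient hξ (k + 1)).ne_zero
    rw [completeQuotient, ← h, inv_zero] at this
    exact this rfl
  exact (one_lt_inv₀ h0).2 (Int.fract_lt_one _)

theorem completeQuotient_eq {ξ : ℝ} (k : ℕ) :
    completeQuotient ξ k = partialQuotient ξ k + 1 / completeQuotient ξ (k + 1) := by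
  rw [completeQuotient, one_div, inv_inv, partialQuotient, Int.floor_add_fract]

theorem one_le_partialQuotient {ξ : ℝ} (hξ : Irrational ξ) (k : ℕ) :
    1 ≤ partialQuotient ξ (k + 1) :=
  Int.le_floor.2 (by exact_mod_cast (one_lt_completeQuotient hξ k).le)

theorem convergentRow_det (b : ℕ → ℤ) (k : ℕ) :
    (convergentRow b (1, 0) k).1 * (convergentRow b (0, 1) k).2 -
      (convergentRow b (1, 0) k).2 * (convergentRow b (0, 1) k).1 = 1 ∨
    (convergentRow b (1, 0) k).1 * (convergentRow b (0, 1) k).2 -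
      (convergentRow b (1, 0) k).2 * (convergentRow b (0, 1) k).1 = -1 := by
  induction k with
  | zero => left; simp [convergentRow]
  | succ k ih =>
    simp only [convergentRow]
    rcases ih with h | h
    · right; linear_combination -h
    · left; linear_combination -h

theorem convergentRow_completeQuotient {ξ : ℝ} (hξ : Irrational ξ) (k : ℕ) :
    ((convergentRow (partialQuotient ξ) (1, 0) k).1 : ℝ) * completeQuotient ξ k +
        (convergentRow (partialQuotient ξ) (1, 0) k).2 =
      ξ * ((convergentRow (partialQuotient ξ) (0, 1) k).1 * completeQuotient ξ k +
        (convergentRow (partialQuotient ξ) (0, 1) k).2) := by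
  induction k with
  | zero => simp [convergentRow, completeQuotient]
  | succ k ih =>
    have h := zero_lt_one.trans (one_lt_completeQuotient hξ k)
    rw [completeQuotient_eq] at ih
    simp only [convergentRow]
    push_cast
    field_simp at ih
    linear_combination ih

theorem fib_le_convergentRow {ξ : ℝ} (hξ : Irrational ξ) (k : ℕ) :
    (Nat.fib k : ℤ) ≤ (convergentRow (partialQuotient ξ) (0, 1) k).1 ∧
      (Nat.fib (k + 1) : ℤ) ≤ (convergentRow (partialQuotient ξ) (0, 1) (k + 1)).1 := by
  induction k with
  | zero => simp [convergentRow]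
  | succ k ih =>
    refine ⟨ih.2, ?_⟩
    have hb := one_le_partialQuotient hξ k
    have e : (convergentRow (partialQuotient ξ) (0, 1) (k + 1 + 1)).1 =
      (convergentRow (partialQuotient ξ) (0, 1) (k + 1)).1 * partialQuotient ξ (k + 1) +
        (convergentRow (partialQuotient ξ) (0, 1) k).1 := rfl
    rw [e, Nat.fib_add_two]
    push_cast
    have := le_mul_of_one_le_right ((Int.natCast_nonneg _).trans ih.2) hb
    linarith [ih.1, ih.2]

theorem convergentRow_snd_nonneg {ξ : ℝ} (hξ : Irrational ξ) (k : ℕ) :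
    0 ≤ (convergentRow (partialQuotient ξ) (0, 1) k).2 := by
  cases k with
  | zero => simp [convergentRow]
  | succ k => exact (Int.natCast_nonneg _).trans (fib_le_convergentRow hξ k).1

/-- The complete quotients are eventually bounded by the qualities of the convergents. -/
theorem eventually_completeQuotient_le (hn : 1 ≤ n) {ξ : ℝ} (hξ : Irrational ξ) {a : ℝ}
    (ha : ∀ᶠ q in ratNhds ξ, nQuality n ξ q ≤ a) : ∀ᶠ k in atTop, completeQuotient ξ k ≤ a := by
  set s : ℕ → ℤ := fun k => (convergentRow (partialQuotient ξ) (1, 0) k).1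
  set t : ℕ → ℤ := fun k => (convergentRow (partialQuotient ξ) (0, 1) k).1
  set D : ℕ → ℤ := fun k => (convergentRow (partialQuotient ξ) (0, 1) k).2
  have hst : ∀ k, Int.gcd (s k) (t k) = 1 := fun k => by
    rw [← Int.isCoprime_iff_gcd_eq_one]
    rcases convergentRow_det (partialQuotient ξ) k with h | h
    · exact ⟨D k, -(convergentRow (partialQuotient ξ) (1, 0) k).2, by linear_combination h⟩
    · exact ⟨-D k, (convergentRow (partialQuotient ξ) (1, 0) k).2, by linear_combination -h⟩
  have hpos : ∀ k, 0 < t (k + 1) := fun k =>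
    lt_of_lt_of_le (by exact_mod_cast Nat.fib_pos.2 k.succ_pos) (fib_le_convergentRow hξ k).2
  have hden : ∀ k, (0 : ℝ) < t (k + 1) * completeQuotient ξ (k + 1) + D (k + 1) := fun k => by
    have h1 : (0 : ℝ) < t (k + 1) := by exact_mod_cast hpos k
    have h2 : (0 : ℝ) ≤ D (k + 1) := by exact_mod_cast convergentRow_snd_nonneg hξ (k + 1)
    have h3 := one_lt_completeQuotient hξ k
    positivity
  -- Hence the quality of the convergent is `gcd(t, n) (t ξ_k + D) / t ≥ ξ_k`, with `ξ_k` the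
  -- complete quotient. Indices start at 1 because `t 0 = 0` and `ξ` itself need not exceed 1.
  have herr : ∀ k, |(s (k + 1) : ℝ) - ξ * t (k + 1)| =
      (t (k + 1) * completeQuotient ξ (k + 1) + D (k + 1))⁻¹ := fun k => by
    have hmul : ∀ y : ℝ, |y| * (t (k + 1) * completeQuotient ξ (k + 1) + D (k + 1)) =
        |y * (t (k + 1) * completeQuotient ξ (k + 1) + D (k + 1))| := fun y => by
      rw [abs_mul, abs_of_pos (hden k)]
    rw [← one_div, eq_div_iff (hden k).ne', hmul, ← det_abs (convergentRow_det (partialQuotient ξ) (k + 1))]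
    congr 1
    have := convergentRow_completeQuotient hξ (k + 1)
    linear_combination (t (k + 1) : ℝ) * this
  have hzero : Tendsto (fun k => |(s (k + 1) : ℝ) - ξ * t (k + 1)|) atTop (𝓝 0) := by
    have hlim : Tendsto (fun k : ℕ => (t (k + 1) : ℝ)⁻¹) atTop (𝓝 0) := by
      refine Tendsto.inv_tendsto_atTop (tendsto_atTop_mono (fun k => ?_)
        tendsto_natCast_atTop_atTop)
      have h1 : ((k + 1 : ℕ) : ℤ) ≤ Nat.fib (k + 1) + 1 := by exact_mod_cast Nat.le_fib_add_one _
      have h2 := (fib_le_convergentRow hξ k).2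
      have h3 : (k : ℤ) ≤ t (k + 1) := by
        change _ ≤ t (k + 1) at h2
        push_cast at h1
        linarith
      exact_mod_cast h3
    refine squeeze_zero (fun k => abs_nonneg _) (fun k => ?_) hlim
    rw [herr]
    have h1 : (0 : ℝ) < t (k + 1) := by exact_mod_cast hpos k
    have h2 : (0 : ℝ) ≤ D (k + 1) := by exact_mod_cast convergentRow_snd_nonneg hξ (k + 1)
    have h3 := one_lt_completeQuotient hξ k
    gcongr
    nlinarith
  obtain ⟨-, hlim⟩ := tendsto_div_of_tendsto_sub (fun k => hst (k + 1)) hzero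
  have hev := (tendsto_ratNhds hξ hlim).eventually ha
  rw [← map_add_atTop_eq_nat 1, eventually_map]
  filter_upwards [hev] with k hk
  refine le_trans ?_ hk
  have h1 : (0 : ℝ) < t (k + 1) := by exact_mod_cast hpos k
  have h2 : (0 : ℝ) ≤ D (k + 1) := by exact_mod_cast convergentRow_snd_nonneg hξ (k + 1)
  have h3 := one_lt_completeQuotient hξ k
  have h4 : (1 : ℝ) ≤ Int.gcd (t (k + 1)) n := by
    exact_mod_cast Int.gcd_pos_of_ne_zero_right _ (by omega)
  rw [nQuality_div _ (hst (k + 1)) (hpos k).ne', herr, abs_of_pos h1, le_div_iff₀ (by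
    have := hden k
    positivity), ← div_eq_mul_inv, ← mul_div_assoc, div_le_iff₀ (hden k)]
  calc _ ≤ (1 : ℝ) * (t (k + 1) * completeQuotient ξ (k + 1) + D (k + 1)) := by linarith
    _ ≤ _ := by gcongr

/-- Every irrational number of bounded quality is coded by a path with bounded digits. -/
theorem exists_path_of_nQuality_le (hn : 1 ≤ n) {ξ : ℝ} (hξ : Irrational ξ) {a : ℝ}
    (ha : ∀ᶠ q in ratNhds ξ, nQuality n ξ q ≤ a) (hK : a ≤ K) :
    ∃ (x : ℤ → Letter K n) (p q c d : ℤ), IsPath Transition x ∧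
      (p * d - q * c = 1 ∨ p * d - q * c = -1) ∧ (x 0).2 = ((c : ZMod n), (d : ZMod n)) ∧
      ξ = moebius p q c d (up x) := by
  obtain ⟨k₀, hk₀⟩ := eventually_atTop.1 (eventually_completeQuotient_le hn hξ ha)
  set m : ℕ → ℕ := fun i => k₀ + i + 1 with hm
  have hb1 : ∀ i, 1 ≤ partialQuotient ξ (m i) := fun i => one_le_partialQuotient hξ _
  have hbK : ∀ i, partialQuotient ξ (m i) ≤ K := fun i => by
    have h1 : (partialQuotient ξ (m i) : ℝ) ≤ completeQuotient ξ (m i) := Int.floor_le _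
    have h2 := hk₀ (m i) (by simp only [hm]; omega)
    exact_mod_cast h1.trans (h2.trans hK)
  -- The letters at negative positions are arbitrary (the letter at 0 is repeated): only the
  -- nonnegative part must be a path.
  set x : ℤ → Letter K n := fun i =>
    (⟨(partialQuotient ξ (m i.toNat) - 1).toNat, by
      have := hb1 i.toNat; have := hbK i.toNat; omega⟩,
      ((convergentRow (partialQuotient ξ) (0, 1) (m i.toNat)).1 : ZMod n),
      ((convergentRow (partialQuotient ξ) (0, 1) (m i.toNat)).2 : ZMod n)) with hx
  have hdigit : ∀ i : ℕ, (((x i).1 : ℕ) : ℤ) + 1 = partialQuotient ξ (m i) := fun i => by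
    have := hb1 i
    simp only [hx, Int.toNat_natCast]
    omega
  have hup : completeQuotient ξ (m 0) = up x := by
    refine cfValue_unique _ (fun i => completeQuotient ξ (m i))
      (fun i => (one_lt_completeQuotient hξ _).le) (fun i => ?_) fun i => ?_
    · have := hk₀ (m i) (by simp only [hm]; omega)
      linarith
    · have h1 : ((((x i).1 : ℕ) : ℝ)) + 1 = partialQuotient ξ (m i) := by
        exact_mod_cast hdigit i
      rw [h1]
      exact completeQuotient_eq (m i)
  refine ⟨x, (convergentRow (partialQuotient ξ) (1, 0) (m 0)).1,
    (convergentRow (partialQuotient ξ) (1, 0) (m 0)).2,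
    (convergentRow (partialQuotient ξ) (0, 1) (m 0)).1,
    (convergentRow (partialQuotient ξ) (0, 1) (m 0)).2, fun i => ⟨?_, ?_⟩,
    convergentRow_det _ _, rfl, ?_⟩
  · refine ⟨_, _, ?_, rfl⟩
    simp only [Int.toNat_natCast]
    rcases convergentRow_det (partialQuotient ξ) (m i) with h | h
    · exact ⟨-(convergentRow (partialQuotient ξ) (1, 0) (m i)).2,
        (convergentRow (partialQuotient ξ) (1, 0) (m i)).1, by linear_combination h⟩
    · exact ⟨(convergentRow (partialQuotient ξ) (1, 0) (m i)).2,
        -(convergentRow (partialQuotient ξ) (1, 0) (m i)).1, by linear_combination -h⟩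
  · have h1 : ((((x i).1 : ℕ) : ZMod n)) + 1 = partialQuotient ξ (m i) := by
      rw [← hdigit]; push_cast; rfl
    rw [h1]
    have h2 : ((i : ℤ) + 1).toNat = i + 1 := by omega
    have h3 : m (i + 1) = m i + 1 := rfl
    simp only [hx, h2, Int.toNat_natCast, h3, convergentRow]
    push_cast
    rfl
  · rw [← hup, moebius, eq_div_iff, ← convergentRow_completeQuotient hξ]
    rw [hup]
    exact denom_ne_zero (convergentRow_det _ _) x

/-! ### Periodic paths and quadratic irrationals -/

/-- The polynomial is transported by the inverse matrix. If its new leading coefficient vanished,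
irrationality would kill the other two as well, and transporting back would give `a = 0`. -/
theorem isQuadraticIrrational_moebius {p q c d : ℤ}
    (hdet : p * d - q * c = 1 ∨ p * d - q * c = -1) {x : ℤ → Letter K n} {a b e : ℤ} (ha : a ≠ 0)
    (h : (a : ℝ) * up x ^ 2 + b * up x + e = 0) :
    IsQuadraticIrrational (moebius p q c d (up x)) := by
  have hirr := irrational_moebius hdet x
  have hD := denom_ne_zero hdet x
  have hd2 : (p * d - q * c) * (p * d - q * c) = 1 := by rcases hdet with h | h <;> rw [h] <;> rfl
  set a' : ℤ := a * d ^ 2 - b * d * c + e * c ^ 2 with ha'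
  set b' : ℤ := -2 * a * d * q + b * (d * p + q * c) - 2 * e * p * c with hb'
  set c' : ℤ := a * q ^ 2 - b * q * p + e * p ^ 2 with hc'
  have heq : (a' : ℝ) * moebius p q c d (up x) ^ 2 + b' * moebius p q c d (up x) + c' = 0 := by
    have hs : moebius p q c d (up x) * (c * up x + d) = p * up x + q := div_mul_cancel₀ _ hD
    refine (mul_eq_zero.1 ?_).resolve_left (pow_ne_zero 2 hD)
    generalize moebius p q c d (up x) = s at hs ⊢
    rw [ha', hb', hc']
    push_cast
    linear_combination (((a : ℝ) * d ^ 2 - b * d * c + e * c ^ 2) *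
      (s * (c * up x + d) + (p * up x + q)) +
      (-2 * a * d * q + b * (d * p + q * c) - 2 * e * p * c) * (c * up x + d)) * hs +
      ((p : ℝ) * d - q * c) ^ 2 * h
  refine ⟨hirr, a', b', c', fun h0 => ha ?_, heq⟩
  have hb0 : b' = 0 := by
    by_contra hb0
    refine hirr ⟨-c' / b', ?_⟩
    have hb1 : (b' : ℝ) ≠ 0 := by exact_mod_cast hb0
    push_cast
    rw [div_eq_iff hb1]
    rw [h0] at heq
    push_cast at heq
    linarith
  have hc0 : c' = 0 := by
    rw [h0, hb0] at heq
    simpa using heq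
  linear_combination -a * hd2 + p ^ 2 * h0 + p * c * hb0 + c ^ 2 * hc0 -
    p ^ 2 * ha' - p * c * hb' - c ^ 2 * hc'

/-- Iterating `up_eq` makes `up x` a Möbius image of its shift. The bound `1 ≤ c` for `k ≥ 1` makes
the equation nondegenerate when the shift fixes `x`. -/
theorem exists_up_relation (x : ℤ → Letter K n) (k : ℕ) :
    ∃ p q c d : ℤ, 0 ≤ c ∧ 0 ≤ d ∧ 1 ≤ c + d ∧ (1 ≤ k → 1 ≤ c) ∧
      up x * (c * up (shiftSeq k x) + d) = p * up (shiftSeq k x) + q := by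
  induction k with
  | zero => exact ⟨1, 0, 0, 1, le_rfl, zero_le_one, by simp, by simp, by simp [shiftSeq_zero]⟩
  | succ k ih =>
    obtain ⟨p, q, c, d, hc, hd, hcd, -, h⟩ := ih
    have hb : 1 ≤ digit (shiftSeq (k : ℤ) x) := by simp [digit]
    have hcb := le_mul_of_one_le_right hc hb
    refine ⟨p * digit (shiftSeq k x) + q, p, c * digit (shiftSeq k x) + d, c, by linarith, hc,
      by linarith, fun _ => by linarith, ?_⟩
    have hu := zero_lt_one.trans (one_lt_up (shiftSeq 1 (shiftSeq (k : ℤ) x)))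
    rw [up_eq (shiftSeq (k : ℤ) x)] at h
    rw [← shiftSeq_one_natCast]
    field_simp at h
    push_cast
    linear_combination h

theorem exists_quadratic_of_periodic {x : ℤ → Letter K n} {p : ℤ} (hp : 0 < p)
    (hx : Function.Periodic x p) :
    ∃ a b e : ℤ, a ≠ 0 ∧ (a : ℝ) * up x ^ 2 + b * up x + e = 0 := by
  obtain ⟨s, t, c, d, -, -, -, hc, h⟩ := exists_up_relation x p.toNat
  have e : shiftSeq ((p.toNat : ℕ) : ℤ) x = x := by
    rw [Int.toNat_of_nonneg hp.le]
    exact funext hx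
  rw [e] at h
  have := hc (by omega)
  refine ⟨c, d - s, -t, by omega, ?_⟩
  push_cast
  linear_combination h

/-! ### The spectrum in terms of paths -/

theorem windowContinuous_localQuality [NeZero n] (R : ℕ) :
    WindowContinuous (localQuality (K := K) (n := n) R) :=
  .of_continuous (continuous_localQuality R)

theorem exists_moebius_row {x : ℤ → Letter K n} (hx : IsPath Transition x) :
    ∃ p q c d : ℤ, (p * d - q * c = 1 ∨ p * d - q * c = -1) ∧
      (x 0).2 = ((c : ZMod n), (d : ZMod n)) := by
  obtain ⟨⟨c, d, ⟨u, v, huv⟩, hrow⟩, -⟩ := hx 0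
  exact ⟨v, -u, c, d, Or.inl (by linear_combination huv), by simpa using hrow⟩

theorem mem_nLagrangeSpectrum_of_path [NeZero n] {x : ℤ → Letter K n} (hx : IsPath Transition x)
    {a : ℝ}
    (ha : HasLimsup (fun k : ℕ => localQuality (boxRadius K n) (shiftSeq k x)) atTop a) :
    a ∈ nLagrangeSpectrum n := by
  obtain ⟨p, q, c, d, hdet, hrow⟩ := exists_moebius_row hx
  exact ⟨_, irrational_moebius hdet x, (limsup_coe_eq_iff _ _ _).2
    (hasLimsup_nQuality hdet hx hrow ha)⟩

theorem mem_quadraticApproximabilities_of_path [NeZero n] {x : ℤ → Letter K n}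
    (hx : IsPath Transition x) {p : ℤ} (hp : 0 < p) (hper : Function.Periodic x p) {a : ℝ}
    (ha : HasLimsup (fun k : ℕ => localQuality (boxRadius K n) (shiftSeq k x)) atTop a) :
    a ∈ quadraticApproximabilities n := by
  obtain ⟨p, q, c, d, hdet, hrow⟩ := exists_moebius_row hx
  obtain ⟨s, t, u, hs, h⟩ := exists_quadratic_of_periodic hp hper
  exact ⟨_, isQuadraticIrrational_moebius hdet hs h, (limsup_coe_eq_iff _ _ _).2
    (hasLimsup_nQuality hdet hx hrow ha)⟩

/-- Qualities near `ξ` are eventually at most `a + 1`, so digits up to `K` suffice; the limsup along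
the coding path must be `a` by uniqueness. -/
theorem exists_path_of_mem_nLagrangeSpectrum [NeZero n] {a : ℝ} (ha : a ∈ nLagrangeSpectrum n)
    (hK : a + 1 ≤ K) : ∃ x : ℤ → Letter K n, IsPath Transition x ∧
      HasLimsup (fun k : ℕ => localQuality (boxRadius K n) (shiftSeq k x)) atTop a := by
  obtain ⟨ξ, hξ, hlim⟩ := ha
  replace hlim : HasLimsup (nQuality n ξ) (ratNhds ξ) a := (limsup_coe_eq_iff _ _ _).1 hlim
  obtain ⟨x, p, q, c, d, hx, hdet, hrow, rfl⟩ :=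
    exists_path_of_nQuality_le (NeZero.one_le) hξ (hlim 1 one_pos).1 hK
  obtain ⟨C, hC⟩ := exists_localQuality_bound (K := K) (n := n) (boxRadius K n)
  obtain ⟨b, hb⟩ := exists_hasLimsup
    (fun k : ℕ => localQuality (boxRadius K n) (shiftSeq k x)) atTop C fun k => hC _
  rw [hlim.unique (hasLimsup_nQuality hdet hx hrow hb)]
  exact ⟨x, hx, hb⟩

theorem exists_periodic_of_mem_nLagrangeSpectrum [NeZero n] {a : ℝ}
    (ha : a ∈ nLagrangeSpectrum n) (hK : a + 1 ≤ K) {ε : ℝ} (hε : 0 < ε) :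
    ∃ (y : ℤ → Letter K n) (p : ℤ) (b : ℝ), 0 < p ∧ Function.Periodic y p ∧
      IsPath Transition y ∧
      HasLimsup (fun k : ℕ => localQuality (boxRadius K n) (shiftSeq k y)) atTop b ∧
      |b - a| ≤ ε := by
  obtain ⟨x, hx, hlim⟩ := exists_path_of_mem_nLagrangeSpectrum ha hK
  obtain ⟨C, hC⟩ := exists_localQuality_bound (K := K) (n := n) (boxRadius K n)
  exact exists_periodic_hasLimsup (windowContinuous_localQuality _) hC hx hlim hε

theorem nLagrangeSpectrum_eq_closure (n : ℕ) (hn : 1 ≤ n) :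
    nLagrangeSpectrum n = closure (quadraticApproximabilities n) := by
  have : NeZero n := ⟨by omega⟩
  apply Set.Subset.antisymm
  · intro a ha
    obtain ⟨K, hK⟩ := exists_nat_ge (a + 1)
    refine Metric.mem_closure_iff.2 fun ε hε => ?_
    obtain ⟨y, p, b, hp, hy, hT, hb, hba⟩ :=
      exists_periodic_of_mem_nLagrangeSpectrum ha hK (half_pos hε)
    refine ⟨b, mem_quadraticApproximabilities_of_path hT hp hy hb, ?_⟩
    rw [dist_comm, Real.dist_eq]
    linarith
  · intro a ha
    -- Approximating values `b` are taken within 1 of `a`, so `b + 1 ≤ a + 2 ≤ K` and a single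
    -- alphabet serves all of them.
    obtain ⟨K, hK⟩ := exists_nat_ge (a + 2)
    obtain ⟨x, hx, hlim⟩ := exists_path_hasLimsup (T := Transition)
      (windowContinuous_localQuality (K := K) (n := n) (boxRadius K n)) (a := a) fun ε hε => by
        obtain ⟨b, ⟨ξ, hξ, hb⟩, hab⟩ := Metric.mem_closure_iff.1 ha (min 1 (ε / 2)) (by positivity)
        rw [Real.dist_eq] at hab
        have h1 := abs_lt.1 (hab.trans_le (min_le_left _ _))
        have h2 := abs_lt.1 (hab.trans_le (min_le_right _ _))
        obtain ⟨y, p, b', hp, hy, hT, hb', hbb⟩ := exists_periodic_of_mem_nLagrangeSpectrum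
          (K := K) (a := b) ⟨ξ, hξ.1, hb⟩ (by linarith) (half_pos hε)
        have h3 := abs_le.1 hbb
        exact ⟨y, p, b', hp, hy, hT, hb', abs_le.2 ⟨by linarith, by linarith⟩⟩
    exact mem_nLagrangeSpectrum_of_path hx hlim

end Spectrum

theorem mainTheorem4 (n : ℕ) (hn : 1 ≤ n) :
    IsClosed (nLagrangeSpectrum n) ∧
      nLagrangeSpectrum n = closure (quadraticApproximabilities n) := by
  have h := nLagrangeSpectrum_eq_closure n hn
  exact ⟨h ▸ isClosed_closure, h⟩
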